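/- Let $G$ be a finite simple graph with $m$ edges and minimum degree $\delta(G)\ge 33$. Then $G$ admits an antimagic orientation; that is, the edges of $G$ can each be given one of their two directions, producing a directed graph $D$, in such a way that there is a bijection $\sigma$ from the set of arcs of $D$ to $\{1,2,\dots,m\}$ for which the oriented vertex sums $$s(v)=\sum_{\text{arcs } a \text{ entering } v}\sigma(a)-\sum_{\text{arcs } a \text{ leaving } v}\sigma(a)\qquad (v\in V(G))$$ are pairwise distinct. -/

import Mathlib

namespace AntimagicOrientation

/-- The set of arcs of a digraph; the arc `(u, v)` leaves `u` and enters `v`. -/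
def arcSet {V : Type*} (D : Digraph V) : Set (V × V) :=
  {a | D.Adj a.1 a.2}

/-- `D` is an orientation of the simple graph `G`: the arcs of `D` join exactly the adjacent
pairs of `G`, and every edge of `G` receives exactly one of its two directions. -/
structure IsOrientation {V : Type*} (G : SimpleGraph V) (D : Digraph V) : Prop where
  adj_iff : ∀ u v : V, G.Adj u v ↔ D.Adj u v ∨ D.Adj v u
  asymm : ∀ u v : V, D.Adj u v → ¬ D.Adj v u

open Classical in
/-- The oriented vertex sum at `v`: the sum of the labels of all arcs entering `v` minus the sum
of the labels of all arcs leaving `v`. Only the values of `σ` on arcs matter. -/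
noncomputable def orientedSum {V : Type*} [Fintype V] (D : Digraph V) (σ : V × V → ℤ)
    (v : V) : ℤ :=
  (∑ u : V with D.Adj u v, σ (u, v)) - ∑ w : V with D.Adj v w, σ (v, w)

/-- `σ` restricts to a bijection from the `m` arcs of `D` onto `{1, …, m}`, and the oriented
sums at distinct vertices are distinct. -/
structure IsAntimagicLabeling {V : Type*} [Fintype V] (D : Digraph V) (σ : V × V → ℤ) :
    Prop where
  bijOn : Set.BijOn σ (arcSet D) (Set.Icc 1 ((arcSet D).ncard : ℤ))
  injective_sum : Function.Injective (orientedSum D σ)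

/-- A digraph is antimagic if it admits an antimagic labeling. -/
def IsAntimagic {V : Type*} [Fintype V] (D : Digraph V) : Prop :=
  ∃ σ : V × V → ℤ, IsAntimagicLabeling D σ

/-- A graph admits an antimagic orientation if some orientation of it is antimagic. -/
def HasAntimagicOrientation {V : Type*} [Fintype V] (G : SimpleGraph V) : Prop :=
  ∃ D : Digraph V, IsOrientation G D ∧ IsAntimagic D

end AntimagicOrientation

/-! Let `C = m + 1`. Choose `X` so that each of its vertices has at least half of its neighbours
outside and the complement `Y` can be matched into it (`exists_partition`). All edges between the
parts point from `X` to `Y`. Labels are arranged so that sums on `X` are below `-C` (`net_lt`) and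
sums on `Y` above `-C` (`net_ge`); collisions can then occur only within a part.

On `X` the sums are told apart modulo `C`. Each arc inside `X` shares its tail with a companion arc
to `Y` of complementary label (total `C`). At its head it is paired with another incoming arc (total
`C ± 1`, signs alternating), or, if left over, cancelled up to 1 by an arc to `Y`. Further arcs to
`Y` come in complementary pairs. So up to an error in `[-1, 1]` and a multiple of `C`, the sum at
`x` is minus the label of one root arc, and minus, when parity demands it, a triple of arcs to `Y`
of total about `3C/2`. Root labels are 5 apart and never differ by about `C/2`, so the sums are
distinct (`net_ne`).

Inside `Y`, orienting along trails keeps each vertex from losing more than `m`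
(`exists_orientation_sum_ge`). The matching edges are root arcs; permuting their labels makes the
sums on `Y` distinct (`exists_perm_add_injective`), and the argument on `X` is indifferent to which
vertex has which root label.

Degree 33, with an orientation of `X` balanced at vertices of inner degree at least 16
(`exists_balanced_orientation`), leaves enough arcs for all these roles (`exists_role_sizes`) and
enough paired labels to make room for the spaced root labels (`exists_isLabeling`). -/

namespace AntimagicOrientation

open Finset

set_option linter.unusedSectionVars false

/-! ### Cuts and Hall's theorem: the vertex partition. -/

section Partition

variable {V : Type*} [Fintype V] [DecidableEq V] (G : SimpleGraph V) [DecidableRel G.Adj]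

/-- The number of neighbours of `v` in the finite set `A`. -/
def degIn (A : Finset V) (v : V) : ℕ := #{u ∈ A | G.Adj v u}

variable {G}

theorem degIn_union {A B : Finset V} (h : Disjoint A B) (v : V) :
    degIn G (A ∪ B) v = degIn G A v + degIn G B v := by
  unfold degIn
  rw [filter_union, card_union_of_disjoint (disjoint_filter_filter h)]

theorem degIn_insert {A : Finset V} {w : V} (hw : w ∉ A) (v : V) :
    degIn G (insert w A) v = degIn G A v + if G.Adj v w then 1 else 0 := by
  unfold degIn
  rw [filter_insert]
  split_ifs
  · rw [card_insert_of_notMem (by simp [hw])]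
  · simp

theorem sum_degIn_insert {A : Finset V} {w : V} (hw : w ∉ A) :
    ∑ x ∈ insert w A, degIn G (insert w A) x = ∑ x ∈ A, degIn G A x + 2 * degIn G A w := by
  rw [sum_insert hw, sum_congr rfl (fun x _ => degIn_insert hw x), sum_add_distrib,
    degIn_insert hw]
  have : (∑ x ∈ A, if G.Adj x w then 1 else 0) = degIn G A w := by
    rw [degIn, card_filter]
    simp only [G.adj_comm]
  rw [this]
  simp
  ring

theorem degIn_erase_self (A : Finset V) (v : V) : degIn G (A.erase v) v = degIn G A v := by
  unfold degIn
  congr 1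
  ext u
  simp only [mem_filter, mem_erase]
  constructor
  · rintro ⟨⟨-, h⟩, h'⟩
    exact ⟨h, h'⟩
  · rintro ⟨h, h'⟩
    exact ⟨⟨h'.ne', h⟩, h'⟩

variable (G) in
/-- A maximum cut: every vertex has at least as many neighbours across as on its own side. -/
theorem exists_maxCut : ∃ X : Finset V, (∀ x ∈ X, degIn G X x ≤ degIn G Xᶜ x) ∧
    ∀ y ∈ Xᶜ, degIn G Xᶜ y ≤ degIn G X y := by
  -- The quantity is twice the number of edges inside the parts; moving one vertex across changes it
  -- by twice the difference of its two degrees.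
  obtain ⟨X, -, hX⟩ := exists_min_image (univ : Finset (Finset V))
    (fun X => ∑ x ∈ X, degIn G X x + ∑ x ∈ Xᶜ, degIn G Xᶜ x) ⟨∅, mem_univ _⟩
  refine ⟨X, fun x hx => ?_, fun y hy => ?_⟩
  · have h := hX (X.erase x) (mem_univ _)
    have h1 := sum_degIn_insert (G := G) (notMem_erase x X)
    rw [insert_erase hx] at h1
    have h2 : (X.erase x)ᶜ = insert x Xᶜ := by
      ext u; by_cases hu : u = x <;> simp [hu]
    simp only [h1, h2] at h
    rw [sum_degIn_insert (by simpa using hx), degIn_erase_self] at h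
    omega
  · have hy' : y ∉ X := by simpa using hy
    have h := hX (insert y X) (mem_univ _)
    have h1 := sum_degIn_insert (G := G) (notMem_erase y Xᶜ)
    rw [insert_erase hy] at h1
    have h2 : (insert y X)ᶜ = Xᶜ.erase y := by
      ext u; by_cases hu : u = y <;> simp [hu]
    simp only [h1, h2] at h
    rw [sum_degIn_insert hy', degIn_erase_self] at h
    omega

/-- The neighbours in `X` of the vertices of `S`. -/
def nbrsIn (G : SimpleGraph V) [DecidableRel G.Adj] (X S : Finset V) : Finset V :=
  {x ∈ X | ∃ s ∈ S, G.Adj s x}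

theorem mem_nbrsIn {X S : Finset V} {x : V} :
    x ∈ nbrsIn G X S ↔ x ∈ X ∧ ∃ s ∈ S, G.Adj s x := by
  simp [nbrsIn]

theorem nbrsIn_subset (X S : Finset V) : nbrsIn G X S ⊆ X := filter_subset _ _

/-- Hall's theorem for the bipartite graph between `A` and `B`. -/
theorem exists_matching {A B : Finset V} (h : ∀ R ⊆ A, #R ≤ #(nbrsIn G B R)) :
    ∃ M : V → V, Set.InjOn M A ∧ ∀ a ∈ A, G.Adj a (M a) ∧ M a ∈ B := by
  obtain ⟨f, hf, hf'⟩ := (Finset.all_card_le_biUnion_card_iff_exists_injective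
    (fun a : A => {b ∈ B | G.Adj a b})).1 (by
      intro s
      have := h (s.map (Function.Embedding.subtype _)) (by
        intro x hx
        obtain ⟨a, -, rfl⟩ := mem_map.1 hx
        exact a.2)
      rw [card_map] at this
      refine this.trans (card_le_card ?_)
      intro x hx
      obtain ⟨hx, t, ht, htx⟩ := mem_nbrsIn.1 hx
      obtain ⟨a, ha, rfl⟩ := mem_map.1 ht
      exact mem_biUnion.2 ⟨a, ha, mem_filter.2 ⟨hx, htx⟩⟩)
  refine ⟨fun v => if hv : v ∈ A then f ⟨v, hv⟩ else v, ?_, ?_⟩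
  · intro a ha b hb hab
    have ha' : a ∈ A := ha
    have hb' : b ∈ A := hb
    simp only [ha', hb', dite_true] at hab
    simpa using hf hab
  · intro a ha
    have := hf' ⟨a, ha⟩
    simp only [ha, dite_true]
    simpa [and_comm] using this

variable (G) in
/-- A vertex set `X` whose vertices have at least as many neighbours outside as inside, and into
which the complement can be matched. -/
theorem exists_partition : ∃ X : Finset V, (∀ x ∈ X, degIn G X x ≤ degIn G Xᶜ x) ∧
    ∃ M : V → V, Set.InjOn M (Xᶜ : Finset V) ∧ ∀ y ∈ Xᶜ, G.Adj y (M y) ∧ M y ∈ X := by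
  obtain ⟨X, hX, hY⟩ := exists_maxCut G
  -- `S` has the largest Hall deficiency. Exchanging it with its neighbourhood `N` keeps the degree
  -- condition, as no edge joins `S` to `X \ N`, and maximality yields Hall's condition for both
  -- halves of the new complement.
  obtain ⟨S, hS, hmax⟩ := exists_max_image (Xᶜ).powerset
    (fun S => (#S : ℤ) - #(nbrsIn G X S)) ⟨∅, by simp⟩
  rw [mem_powerset] at hS
  replace hmax : ∀ R ⊆ Xᶜ, (#R : ℤ) - #(nbrsIn G X R) ≤ #S - #(nbrsIn G X S) :=
    fun R hR => hmax R (mem_powerset.2 hR)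
  set N := nbrsIn G X S with hN
  have hNX : N ⊆ X := filter_subset _ _
  have hSX : Disjoint S X := by
    rw [disjoint_left]; intro a ha; simpa using hS ha
  have hcompl : ((X \ N) ∪ S)ᶜ = (Xᶜ \ S) ∪ N := by
    ext u
    have h1 := @hNX u
    have h2 := @hS u
    simp only [mem_compl, mem_union, mem_sdiff] at *
    tauto
  have dXN : Disjoint (X \ N) S := (hSX.mono_right sdiff_subset).symm
  have dYS : Disjoint (Xᶜ \ S) N := by
    rw [disjoint_left]; intro a ha ha'
    simp only [mem_sdiff, mem_compl] at ha
    exact ha.1 (hNX ha')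
  have splitX (v) : degIn G X v = degIn G (X \ N) v + degIn G N v := by
    rw [← degIn_union sdiff_disjoint, sdiff_union_of_subset hNX]
  have splitY (v) : degIn G Xᶜ v = degIn G (Xᶜ \ S) v + degIn G S v := by
    rw [← degIn_union sdiff_disjoint, sdiff_union_of_subset hS]
  refine ⟨(X \ N) ∪ S, ?_, ?_⟩
  · intro x hx
    rw [hcompl, degIn_union dXN, degIn_union dYS]
    rcases mem_union.1 hx with hx | hx
    · obtain ⟨hxX, hxN⟩ := mem_sdiff.1 hx
      have h0 : degIn G S x = 0 := by
        rw [degIn, card_eq_zero, filter_eq_empty_iff]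
        intro s hs hadj
        exact hxN (mem_nbrsIn.2 ⟨hxX, s, hs, hadj.symm⟩)
      have := hX x hxX
      have := splitX x
      have := splitY x
      omega
    · have h0 : degIn G (X \ N) x = 0 := by
        rw [degIn, card_eq_zero, filter_eq_empty_iff]
        intro s hs hadj
        exact (mem_sdiff.1 hs).2 (mem_nbrsIn.2 ⟨(mem_sdiff.1 hs).1, x, hx, hadj⟩)
      have := hY x (hS hx)
      have := splitX x
      have := splitY x
      omega
  · obtain ⟨M₁, hM₁, hM₁'⟩ := exists_matching (G := G) (A := Xᶜ \ S) (B := X \ N) (by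
      intro R hR
      have hd : Disjoint S R := by
        rw [disjoint_left]; intro a ha ha'; exact (mem_sdiff.1 (hR ha')).2 ha
      have h := hmax (S ∪ R) (union_subset hS (hR.trans sdiff_subset))
      have h2 : nbrsIn G X (S ∪ R) ⊆ N ∪ nbrsIn G (X \ N) R := by
        intro x hx
        obtain ⟨hx, s, hs, hsx⟩ := mem_nbrsIn.1 hx
        by_cases hxN : x ∈ N
        · exact mem_union_left _ hxN
        · rcases mem_union.1 hs with hs | hs
          · exact absurd (mem_nbrsIn.2 ⟨hx, s, hs, hsx⟩) hxN
          · exact mem_union_right _ (mem_nbrsIn.2 ⟨mem_sdiff.2 ⟨hx, hxN⟩, s, hs, hsx⟩)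
      have h3 := (card_le_card h2).trans (card_union_le _ _)
      rw [card_union_of_disjoint hd] at h
      push_cast at h
      omega)
    -- Dropping from `S` the neighbours of `Q` removes `Q` from the neighbourhood, so a violation at
    -- `Q` would produce a larger deficiency.
    obtain ⟨M₂, hM₂, hM₂'⟩ := exists_matching (G := G) (A := N) (B := S) (by
      intro Q hQ
      have h := hmax (S \ nbrsIn G S Q) (sdiff_subset.trans hS)
      have h2 : nbrsIn G X (S \ nbrsIn G S Q) ⊆ N \ Q := by
        intro x hx
        obtain ⟨hx, s, hs, hsx⟩ := mem_nbrsIn.1 hx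
        obtain ⟨hs, hsQ⟩ := mem_sdiff.1 hs
        refine mem_sdiff.2 ⟨mem_nbrsIn.2 ⟨hx, s, hs, hsx⟩, fun hxQ => hsQ ?_⟩
        exact mem_nbrsIn.2 ⟨hs, x, hxQ, hsx.symm⟩
      have h3 := card_le_card h2
      have h4 := card_sdiff_add_card_eq_card hQ
      have h5 := card_sdiff_add_card_eq_card (nbrsIn_subset (G := G) S Q)
      omega)
    rw [hcompl]
    refine ⟨fun v => if v ∈ N then M₂ v else M₁ v, ?_, ?_⟩
    · intro a ha b hb hab
      have ha' := mem_union.1 (mem_coe.1 ha)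
      have hb' := mem_union.1 (mem_coe.1 hb)
      by_cases haN : a ∈ N <;> by_cases hbN : b ∈ N <;> simp only [haN, hbN, if_true, if_false,
        or_false, or_true] at hab ha' hb'
      · exact hM₂ haN hbN hab
      · exact absurd ((hM₁' b hb').2) (by
          rw [← hab]; exact disjoint_right.1 dXN (hM₂' a haN).2)
      · exact absurd ((hM₁' a ha').2) (by
          rw [hab]; exact disjoint_right.1 dXN (hM₂' b hbN).2)
      · exact hM₁ ha' hb' hab
    · intro y hy
      by_cases hyN : y ∈ N
      · simp only [hyN, if_true]
        exact ⟨(hM₂' y hyN).1, mem_union_right _ (hM₂' y hyN).2⟩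
      · have hy' : y ∈ Xᶜ \ S := (mem_union.1 hy).resolve_right hyN
        simp only [hyN, if_false]
        exact ⟨(hM₁' y hy').1, mem_union_left _ (hM₁' y hy').2⟩

end Partition

/-! ### Balanced orientations from private edges. -/

section BalancedOrientation

variable {V : Type*} [Fintype V]

open Classical in
/-- In a finite graph one can assign to every vertex of degree at least `16` eight private
incident edges. -/
theorem exists_private_edges (H : SimpleGraph V) :
    ∃ w : {x // 16 ≤ H.degree x} × Fin 8 → V, (∀ i, H.Adj i.1 (w i)) ∧
      Function.Injective fun i => s((i.1 : V), w i) := by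
  -- Hall's condition: `k` vertices make at most `8 * k` demands and meet at least `16 * k / 2`
  -- edges.
  obtain ⟨f, hf, hf'⟩ := (Finset.all_card_le_biUnion_card_iff_exists_injective
    (fun i : {x // 16 ≤ H.degree x} × Fin 8 => H.incidenceFinset i.1)).1 (by
      intro s
      have h1 : #s ≤ #(s.image Prod.fst) * 8 := by
        have h : s ⊆ s.image Prod.fst ×ˢ (univ : Finset (Fin 8)) := fun i hi =>
          mem_product.2 ⟨mem_image_of_mem _ hi, mem_univ _⟩
        simpa using card_le_card h
      have h2 := card_mul_le_card_mul (s := s.image Prod.fst)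
        (t := s.biUnion fun i => H.incidenceFinset i.1) (m := 16) (n := 2)
        (fun (x : {x // 16 ≤ H.degree x}) e => (x : V) ∈ e) (by
          intro x hx
          obtain ⟨i, hi, rfl⟩ := mem_image.1 hx
          refine i.1.2.trans ?_
          rw [← H.card_incidenceFinset_eq_degree]
          refine card_le_card fun e he => ?_
          rw [mem_bipartiteAbove]
          exact ⟨mem_biUnion.2 ⟨i, hi, he⟩, ((H.mem_incidenceFinset _ _).1 he).2⟩) (by
          intro e _
          induction e with
          | h a b =>
            rw [← card_map (Function.Embedding.subtype _)]
            refine (card_le_card ?_).trans (card_le_two (a := a) (b := b))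
            intro x hx
            obtain ⟨y, hy, rfl⟩ := mem_map.1 hx
            simpa using ((mem_bipartiteBelow _).1 hy).2)
      omega)
  have h : ∀ i, ∃ w, H.Adj i.1 w ∧ f i = s((i.1 : V), w) := by
    intro i
    obtain ⟨h1, h2⟩ := (H.mem_incidenceFinset _ _).1 (hf' i)
    obtain ⟨w, hw⟩ := h2
    exact ⟨w, by rwa [hw] at h1, hw⟩
  choose w hw hfw using h
  refine ⟨w, hw, fun i j hij => hf ?_⟩
  rw [hfw, hfw]
  exact hij

open Classical in
/-- Every finite graph has an orientation in which each vertex of degree at least `16` has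
in-degree and out-degree at least `4`. -/
theorem exists_balanced_orientation (H : SimpleGraph V) :
    ∃ O : V → V → Prop, (∀ u v, H.Adj u v ↔ O u v ∨ O v u) ∧ (∀ u v, O u v → ¬ O v u) ∧
      ∀ x, 16 ≤ H.degree x → 4 ≤ #{u | O u x} ∧ 4 ≤ #{u | O x u} := by
  obtain ⟨w, hw, hinj⟩ := exists_private_edges H
  -- `t` is the tail: of the eight private edges of a vertex, four leave it and four enter it.
  have h : ∀ e : Sym2 V, ∃ t ∈ e, ∀ i, s((i.1 : V), w i) = e →
      t = if i.2 < 4 then (i.1 : V) else w i := by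
    intro e
    by_cases he : ∃ i, s((i.1 : V), w i) = e
    · obtain ⟨i, rfl⟩ := he
      refine ⟨if i.2 < 4 then (i.1 : V) else w i, by split_ifs <;> simp, fun j hj => ?_⟩
      rw [hinj hj]
    · exact ⟨e.out.1, Sym2.out_fst_mem e, fun i hi => absurd ⟨i, hi⟩ he⟩
  choose t ht ht' using h
  refine ⟨fun u v => H.Adj u v ∧ t s(u, v) = u, ?_, ?_, ?_⟩
  · intro u v
    constructor
    · intro h
      rcases Sym2.mem_iff.1 (ht s(u, v)) with h' | h'
      · exact Or.inl ⟨h, h'⟩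
      · exact Or.inr ⟨h.symm, by rw [Sym2.eq_swap]; exact h'⟩
    · rintro (h | h)
      · exact h.1
      · exact h.1.symm
  · rintro u v ⟨h, h1⟩ ⟨-, h2⟩
    rw [Sym2.eq_swap, h1] at h2
    exact h.ne h2
  · intro x hx
    have hwinj : ∀ j k, w (⟨x, hx⟩, j) = w (⟨x, hx⟩, k) → j = k := by
      intro j k hjk
      have : (⟨⟨x, hx⟩, j⟩ : {x // 16 ≤ H.degree x} × Fin 8) = ⟨⟨x, hx⟩, k⟩ := hinj (by simp [hjk])
      simpa using this
    constructor
    · have h4 : #({4, 5, 6, 7} : Finset (Fin 8)) = 4 := rfl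
      rw [← h4]
      refine card_le_card_of_injOn (fun j => w (⟨x, hx⟩, j)) ?_ (fun j _ k _ h => hwinj j k h)
      intro j hj
      have hj4 : ¬ j < 4 := by revert j; decide
      have := ht' _ (⟨x, hx⟩, j) rfl
      simp only [hj4, if_false] at this
      simp only [mem_coe, mem_filter, mem_univ, true_and]
      refine ⟨(hw (⟨x, hx⟩, j)).symm, ?_⟩
      rw [Sym2.eq_swap]
      exact this
    · have h4 : #({0, 1, 2, 3} : Finset (Fin 8)) = 4 := rfl
      rw [← h4]
      refine card_le_card_of_injOn (fun j => w (⟨x, hx⟩, j)) ?_ (fun j _ k _ h => hwinj j k h)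
      intro j hj
      have hj4 : j < 4 := by revert j; decide
      have := ht' _ (⟨x, hx⟩, j) rfl
      simp only [hj4, if_true] at this
      simp only [mem_coe, mem_filter, mem_univ, true_and]
      exact ⟨hw (⟨x, hx⟩, j), this⟩

end BalancedOrientation

/-! ### Orientation along trails with increasing labels. -/

section IncreasingLabels

variable {V : Type*} [DecidableEq V]

/-- Labelling the edges of a finite graph by a nondecreasing sequence, one can orient them so that
every vertex sum is at least `-M`, where `M` bounds the labels, even after a pending amount `p`,
no larger than the labels, is subtracted at one vertex `z`. -/
theorem exists_orientation_sum_ge_pending (g : ℕ → ℤ) (hg : Monotone g) (hg0 : ∀ i, 0 ≤ g i)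
    (M : ℤ) (n : ℕ) : ∀ (E : Finset (Sym2 V)) (k : ℕ) (z : V) (p : ℤ), #E = n → 0 ≤ p →
      p ≤ g k → p ≤ M → (∀ i < k + n, g i ≤ M) →
      ∃ arc : Fin n → V × V, (∀ i, s((arc i).1, (arc i).2) ∈ E) ∧
        (∀ e ∈ E, ∃ i, s((arc i).1, (arc i).2) = e) ∧
        ∀ v, -M ≤ ∑ i : Fin n, ((if v = (arc i).2 then g (k + i) else 0) -
          if v = (arc i).1 then g (k + i) else 0) - if v = z then p else 0 := by
  induction n with
  | zero =>
    intro E k z p hE hp _ hpM _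
    refine ⟨fun i => i.elim0, fun i => i.elim0, ?_, fun v => ?_⟩
    · simp [card_eq_zero.1 hE]
    · simp only [univ_eq_empty, sum_empty]
      split_ifs <;> linarith
  | succ n ih =>
    intro E k z p hE hp hpk hpM hM
    -- The trail grows backwards: the new arc enters `z` if an edge remains there, its label pays
    -- for `p`, and that label becomes the pending loss at `w`. If no edge remains at `z`, its sum
    -- is final and a new trail starts anywhere.
    obtain ⟨z', w, hzw, hz⟩ : ∃ z' w, s(w, z') ∈ E ∧ (z ≠ z' → ∀ e ∈ E, z ∉ e) := by
      by_cases h : ∃ e ∈ E, z ∈ e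
      · obtain ⟨e, he, hze⟩ := h
        obtain ⟨w, rfl⟩ := hze
        exact ⟨z, w, by rwa [Sym2.eq_swap], fun h => absurd rfl h⟩
      · push Not at h
        obtain ⟨e, he⟩ : E.Nonempty := card_pos.1 (by omega)
        induction e with
        | h a b => exact ⟨b, a, he, fun _ => h⟩
    obtain ⟨arc, h1, h2, h3⟩ := ih (E.erase s(w, z')) (k + 1) w (g k)
      (by rw [card_erase_of_mem hzw, hE]; rfl) (hg0 k) (hg (Nat.le_succ k)) (hM k (by omega))
      (fun i hi => hM i (by omega))
    refine ⟨Fin.cons (w, z') arc, ?_, ?_, ?_⟩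
    · intro i
      refine Fin.cases ?_ (fun i => ?_) i
      · exact hzw
      · exact (mem_erase.1 (h1 i)).2
    · intro e he
      by_cases h : e = s(w, z')
      · exact ⟨0, h.symm⟩
      · obtain ⟨i, hi⟩ := h2 e (mem_erase.2 ⟨h, he⟩)
        exact ⟨i.succ, hi⟩
    · intro v
      have h3v := h3 v
      rw [Fin.sum_univ_succ]
      simp only [Fin.cons_zero, Fin.cons_succ, Fin.val_zero, add_zero, Fin.val_succ]
      simp only [add_assoc, add_comm 1] at h3v
      have hk := hg0 k
      by_cases hvz : v = z
      · subst hvz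
        by_cases hvz' : v = z'
        · simp only [if_pos hvz', if_true]
          linarith
        · have hno := hz hvz'
          have hw : v ≠ w := fun h => hno _ hzw (by simp [h])
          have h0 : ∑ i : Fin n, ((if v = (arc i).2 then g (k + (↑i + 1)) else 0) -
              if v = (arc i).1 then g (k + (↑i + 1)) else 0) = 0 := by
            refine sum_eq_zero fun i _ => ?_
            have := hno _ (mem_erase.1 (h1 i)).2
            rw [Sym2.mem_iff] at this
            push Not at this
            simp [this.1, this.2]
          rw [h0]
          simp [hvz', hw]
          linarith
      · simp only [if_neg hvz]
        have : (0 : ℤ) ≤ if v = z' then g k else 0 := by split_ifs <;> linarith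
        linarith

/-- Labelling the edges of a finite graph by a nondecreasing sequence, one can orient them so that
every vertex sum is at least `-M`, where `M` bounds the labels. -/
theorem exists_orientation_sum_ge (g : ℕ → ℤ) (hg : Monotone g) (hg0 : ∀ i, 0 ≤ g i)
    (E : Finset (Sym2 V)) (M : ℤ) (hM0 : 0 ≤ M) (hM : ∀ i < #E, g i ≤ M) :
      ∃ arc : Fin #E → V × V, (∀ i, s((arc i).1, (arc i).2) ∈ E) ∧
        (Function.Injective fun i => s((arc i).1, (arc i).2)) ∧
        (∀ e ∈ E, ∃ i, s((arc i).1, (arc i).2) = e) ∧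
        ∀ v, -M ≤ ∑ i : Fin #E, ((if v = (arc i).2 then g i else 0) -
          if v = (arc i).1 then g i else 0) := by
  rcases isEmpty_or_nonempty V with hV | ⟨⟨z⟩⟩
  · have hE : #E = 0 := by
      rw [card_eq_zero, eq_empty_iff_forall_notMem]
      intro e
      induction e with
      | h a b => exact hV.elim a
    have : IsEmpty (Fin #E) := by rw [hE]; infer_instance
    exact ⟨fun i => isEmptyElim i, fun i => isEmptyElim i, fun i => isEmptyElim i,
      fun e => by induction e with | h a b => exact hV.elim a, fun v => hV.elim v⟩
  · obtain ⟨arc, h1, h2, h3⟩ := exists_orientation_sum_ge_pending g hg hg0 M #E E 0 z 0 rfl le_rfl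
      (hg0 0) hM0 (by simpa using hM)
    refine ⟨arc, h1, ?_, h2, by simpa using h3⟩
    have hb : Function.Bijective fun i => (⟨s((arc i).1, (arc i).2), h1 i⟩ : E) := by
      rw [Fintype.bijective_iff_surjective_and_card]
      refine ⟨fun e => ?_, by simp⟩
      obtain ⟨i, hi⟩ := h2 e e.2
      exact ⟨i, Subtype.ext hi⟩
    intro i j hij
    exact hb.1 (Subtype.ext hij)

end IncreasingLabels

/-! ### Distribution of the labels among the roles. -/

section LabelDesign

/-- The sizes of the families of labels. -/
structure Sizes where
  nR : ℕ
  nT : ℕ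
  nL : ℕ
  nK : ℕ
  nC : ℕ
  nY : ℕ

namespace Sizes

variable (p : Sizes)

/-- One more than the number of labels; labels `x` and `p.C - x` are complementary. -/
def C : ℤ := p.nR + 3 * p.nT + 4 * p.nL + 3 * p.nK + 2 * p.nC + p.nY + 1

/-- The end of the lowest block of labels. -/
def P0 : ℕ := 2 * p.nL + p.nC + p.nR / 2

/-- The beginning of the middle block of labels. -/
def a : ℕ := p.P0 + 3 * (p.nK / 2) + 2 * (p.nK % 2) + 1

/-- The `N`-th label not of the form `15 + 5 * j` with `j < p.nR / 2`. -/
def unitPos (N : ℕ) : ℕ := N + 1 + min (p.nR / 2) ((N / 2 - 5) / 2)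

/-- The inequalities between the sizes that the labelling needs. -/
structure Admissible : Prop where
  nT_le : p.nT ≤ p.nR
  nK_le : p.nK ≤ p.nR
  le_nR : 17 ≤ p.nR
  -- The right side counts the labels used outside `Y`.
  le_sum : 25 * p.nR ≤ p.nR + 3 * p.nT + 4 * p.nL + 3 * p.nK + 2 * p.nC

end Sizes

/-- Codes for labels: a low label or its complement (in three kinds), or a label in the middle. -/
inductive Code
  | unit (N : ℕ) (b : Bool)
  | triple (t : ℕ) (b : Bool)
  | spaced (j : ℕ) (b : Bool)
  | mid (q : ℕ)

namespace Code

variable (p : Sizes)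

/-- The label with a given code. -/
def val : Code → ℤ
  | unit N b => if b then p.C - p.unitPos N else p.unitPos N
  | triple t b => if b then p.C - (p.P0 + 1 + t) else p.P0 + 1 + t
  | spaced j b => if b then p.C - (15 + 5 * j) else 15 + 5 * j
  | mid q => p.a + q

/-- The codes in use. -/
def Valid : Code → Prop
  | unit N _ => N < 2 * p.nL + p.nC
  | triple t b => t < 3 * (p.nK / 2) + if b then p.nK % 2 else 2 * (p.nK % 2)
  | spaced j _ => j < p.nR / 2
  | mid q => q < p.nY + 3 * p.nT + p.nR % 2

variable {p}

theorem unitPos_lt {N N' : ℕ} (h : N < N') : p.unitPos N < p.unitPos N' := by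
  simp only [Sizes.unitPos]
  omega

theorem unitPos_injective : Function.Injective p.unitPos :=
  (strictMono_nat_of_lt_succ fun n => unitPos_lt (Nat.lt_succ_self n)).injective

theorem unitPos_ne {N j : ℕ} (hj : j < p.nR / 2) : p.unitPos N ≠ 15 + 5 * j := by
  have h : (N / 2 < 5 ∧ (N / 2 - 5) / 2 = 0) ∨ N / 2 = 2 * ((N / 2 - 5) / 2) + 5 ∨ N / 2 = 2 * ((N / 2 - 5) / 2) + 6 := by
    omega
  simp only [Sizes.unitPos]
  generalize (N / 2 - 5) / 2 = d at h ⊢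
  have h' : N = 2 * (N / 2) ∨ N = 2 * (N / 2) + 1 := by omega
  generalize N / 2 = u at h h' ⊢
  rcases h with ⟨h, rfl⟩ | rfl | rfl <;> rcases h' with rfl | rfl <;> omega

theorem unitPos_le {N : ℕ} (hN : N < 2 * p.nL + p.nC) : p.unitPos N ≤ p.P0 := by
  simp only [Sizes.unitPos, Sizes.P0]
  omega

theorem unitPos_pos {N : ℕ} : 1 ≤ p.unitPos N := by
  simp only [Sizes.unitPos]
  omega

theorem spaced_le (hp : p.Admissible) {j : ℕ} (hj : j < p.nR / 2) : 15 + 5 * j ≤ p.P0 := by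
  obtain ⟨h1, h2, h3, h4⟩ := hp
  simp only [Sizes.P0]
  omega

/-- The low, middle and high blocks exhaust `1, …, C - 1`; for odd `nK` the high block is one label
shorter than the low one. -/
theorem C_eq : p.C = p.a + (p.P0 + 3 * (p.nK / 2) + p.nK % 2 : ℕ) +
    (p.nY + 3 * p.nT + p.nR % 2 : ℕ) := by
  simp only [Sizes.C, Sizes.a, Sizes.P0]
  omega

theorem a_eq : p.a = p.P0 + 3 * (p.nK / 2) + 2 * (p.nK % 2) + 1 := rfl

theorem val_injective (hp : p.Admissible) {x y : Code} (hx : x.Valid p) (hy : y.Valid p)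
    (h : x.val p = y.val p) : x = y := by
  have hC := C_eq (p := p)
  have ha := a_eq (p := p)
  rcases x with ⟨N, b⟩ | ⟨t, b⟩ | ⟨j, b⟩ | q <;> rcases y with ⟨N', b'⟩ | ⟨t', b'⟩ | ⟨j', b'⟩ | q' <;>
    simp only [Valid, val] at hx hy h
  · have h1 := unitPos_le hx
    have h2 := unitPos_le hy
    have h3 := unitPos_pos (p := p) (N := N)
    have h4 : p.unitPos N = p.unitPos N' ∧ b = b' := by
      cases b <;> cases b' <;> simp at h ⊢ <;> omega
    rw [unitPos_injective h4.1, h4.2]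
  · have h1 := unitPos_le hx
    cases b <;> cases b' <;> simp at h hy <;> omega
  · have h1 := unitPos_le hx
    have h2 := spaced_le hp hy
    have h3 := unitPos_ne (N := N) hy
    cases b <;> cases b' <;> simp at h <;> omega
  · have h1 := unitPos_le hx
    cases b <;> simp at h <;> omega
  · have h1 := unitPos_le hy
    cases b <;> cases b' <;> simp at h hx <;> omega
  · have : t = t' ∧ b = b' := by
      cases b <;> cases b' <;> simp at h hx hy ⊢ <;> omega
    rw [this.1, this.2]
  · have h2 := spaced_le hp hy
    cases b <;> cases b' <;> simp at h hx <;> omega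
  · cases b <;> simp at h hx <;> omega
  · have h1 := unitPos_le hy
    have h2 := spaced_le hp hx
    have h3 := unitPos_ne (N := N') hx
    cases b <;> cases b' <;> simp at h <;> omega
  · have h2 := spaced_le hp hx
    cases b <;> cases b' <;> simp at h hy <;> omega
  · have h1 := spaced_le hp hx
    have h2 := spaced_le hp hy
    have : j = j' ∧ b = b' := by
      cases b <;> cases b' <;> simp at h ⊢ <;> omega
    rw [this.1, this.2]
  · have h2 := spaced_le hp hx
    cases b <;> simp at h <;> omega
  · have h1 := unitPos_le hy
    cases b' <;> simp at h <;> omega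
  · cases b' <;> simp at h hy <;> omega
  · have h2 := spaced_le hp hy
    cases b' <;> simp at h <;> omega
  · congr 1
    omega

theorem val_mem (hp : p.Admissible) {x : Code} (hx : x.Valid p) :
    1 ≤ x.val p ∧ x.val p ≤ p.C - 1 := by
  have hC := C_eq (p := p)
  have ha := a_eq (p := p)
  rcases x with ⟨N, b⟩ | ⟨t, b⟩ | ⟨j, b⟩ | q <;> simp only [Valid, val] at hx ⊢
  · have h1 := unitPos_le hx
    have h3 := unitPos_pos (p := p) (N := N)
    cases b <;> simp <;> omega
  · cases b <;> simp at hx ⊢ <;> omega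
  · have h1 := spaced_le hp hx
    cases b <;> simp <;> omega
  · omega

end Code

/-- The places where labels are needed, indexed by families of indices. -/
inductive Slot (R T L K C Y : Type*)
  | r (i : R)
  | t (i : T) (b : Fin 3)
  | le (i : L) (b : Fin 2)
  | lt (i : L) (b : Fin 2)
  | ke (i : K)
  | kg (i : K)
  | kt (i : K)
  | ch (i : C) (b : Fin 2)
  | y (i : Y)

namespace Sizes

variable (p : Sizes)

/-- The place in the middle block of the `q`-th label of the triples. -/
def tripleMid (q : ℕ) : ℕ := p.nY / 2 + q + if 3 * p.nT / 2 ≤ q then p.nR % 2 else 0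

/-- The position of the `b`-th member of the `j`-th triple. -/
def tripleIdx (j : ℕ) (b : Fin 3) : ℕ :=
  -- One member comes from each third. When `j` grows by two, the first member rises by two and each
  -- of the others falls by one, so the sums stay almost constant.
  if b = 0 then j
  else if b = 1 then
    p.nT + if j % 2 = 0 then (p.nT + 1) / 2 - 1 - j / 2 else p.nT - 1 - j / 2
  else 2 * p.nT + if j % 2 = 0 then p.nT - 1 - j / 2 else p.nT - (p.nT + 1) / 2 - 1 - j / 2

/-- The label code of a slot. -/
def code (sgn : ℕ → Bool) : Slot ℕ ℕ ℕ ℕ ℕ ℕ → Code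
  | .r j => if j < p.nR / 2 then .spaced j false
      else if j < 2 * (p.nR / 2) then .spaced (j - p.nR / 2) true
      else .mid (p.nY / 2 + 3 * p.nT / 2)
  | .t j b => .mid (p.tripleMid (p.tripleIdx j b))
  | .le i b => .unit (2 * i + if sgn i then 1 - b.1 else b.1) (b = 1)
  | .lt i b => .unit (2 * i + if sgn i then 1 - b.1 else b.1) (b = 0)
  -- Indices `2k` and `2k + 1` share three complementary pairs: each takes one pair for `ke` and
  -- `kt`, and they split the middle pair for `kg`.
  | .ke i => if i % 2 = 0 then .triple (3 * (i / 2)) false else .triple (3 * (i / 2) + 2) true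
  | .kg i => .triple (3 * (i / 2) + 1) (i % 2 = 1)
  | .kt i => if i % 2 = 0 then .triple (3 * (i / 2)) true else .triple (3 * (i / 2) + 2) false
  | .ch i b => .unit (2 * p.nL + i) (b = 1)
  -- The `y` labels fill both ends of the middle block, leaving the triples and the odd root label
  -- around `C / 2`.
  | .y i => .mid (if i < p.nY / 2 then i else i + 3 * p.nT + p.nR % 2)

/-- The slots in use. -/
def Used : Slot ℕ ℕ ℕ ℕ ℕ ℕ → Prop
  | .r i => i < p.nR
  | .t i _ => i < p.nT
  | .le i _ => i < p.nL
  | .lt i _ => i < p.nL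
  | .ke i => i < p.nK
  | .kg i => i < p.nK
  | .kt i => i < p.nK
  | .ch i _ => i < p.nC
  | .y i => i < p.nY

variable {p}

theorem tripleIdx_lt {j : ℕ} (hj : j < p.nT) (b : Fin 3) : p.tripleIdx j b < 3 * p.nT := by
  fin_cases b <;> simp [tripleIdx] <;> (try split_ifs) <;> omega

theorem tripleIdx_inj {j j' : ℕ} (hj : j < p.nT) (hj' : j' < p.nT) {b b' : Fin 3}
    (h : p.tripleIdx j b = p.tripleIdx j' b') : j = j' ∧ b = b' := by
  fin_cases b <;> fin_cases b' <;> simp [tripleIdx] at h ⊢ <;> (try split_ifs at h) <;> omega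

theorem tripleMid_inj {q q' : ℕ} (h : p.tripleMid q = p.tripleMid q') : q = q' := by
  simp only [tripleMid] at h
  split_ifs at h <;> omega

theorem code_valid (sgn : ℕ → Bool) {s : Slot ℕ ℕ ℕ ℕ ℕ ℕ} (hs : p.Used s) :
    (p.code sgn s).Valid p := by
  rcases s with i | ⟨i, b⟩ | ⟨i, b⟩ | ⟨i, b⟩ | i | i | i | ⟨i, b⟩ | i <;>
    simp only [Used, code] at hs ⊢
  · split_ifs <;> simp only [Code.Valid] <;> omega
  · have := tripleIdx_lt hs b
    simp only [Code.Valid, tripleMid]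
    split_ifs <;> omega
  · have := b.2
    simp only [Code.Valid]
    split_ifs <;> omega
  · have := b.2
    simp only [Code.Valid]
    split_ifs <;> omega
  · split_ifs <;> simp [Code.Valid] <;> omega
  · by_cases h : i % 2 = 1 <;> simp [Code.Valid, h] <;> omega
  · split_ifs <;> simp [Code.Valid] <;> omega
  · simp only [Code.Valid]; omega
  · simp only [Code.Valid]
    split_ifs <;> omega

theorem code_injective (sgn : ℕ → Bool) {s s' : Slot ℕ ℕ ℕ ℕ ℕ ℕ} (hs : p.Used s)
    (hs' : p.Used s') (h : p.code sgn s = p.code sgn s') : s = s' := by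
  rcases s with i | ⟨i, b⟩ | ⟨i, b⟩ | ⟨i, b⟩ | i | i | i | ⟨i, b⟩ | i <;>
  rcases s' with j | ⟨j, c⟩ | ⟨j, c⟩ | ⟨j, c⟩ | j | j | j | ⟨j, c⟩ | j <;>
    simp only [Used, code] at hs hs' h <;>
    first
    | (exfalso; revert h; simp; done)
    | (exfalso; revert h; split_ifs <;> simp; done)
    | skip
  · have : i = j := by
      split_ifs at h <;> simp at h <;> omega
    rw [this]
  · exfalso
    have := tripleIdx_lt hs' c
    simp only [tripleMid] at h
    split_ifs at h <;> simp at h <;> omega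
  · exfalso
    split_ifs at h <;> simp at h <;> omega
  · exfalso
    have := tripleIdx_lt hs b
    simp only [tripleMid] at h
    split_ifs at h <;> simp at h <;> omega
  · simp only [Code.mid.injEq] at h
    obtain ⟨h1, h2⟩ := tripleIdx_inj hs hs' (tripleMid_inj h)
    rw [h1, h2]
  · exfalso
    have := tripleIdx_lt hs b
    simp only [tripleMid, Code.mid.injEq] at h
    split_ifs at h <;> omega
  · obtain rfl : i = j := by
      fin_cases b <;> fin_cases c <;> simp at h ⊢ <;> split_ifs at h <;> omega
    fin_cases b <;> fin_cases c <;> simp at h ⊢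
  · exfalso
    obtain rfl : i = j := by
      fin_cases b <;> fin_cases c <;> simp at h ⊢ <;> split_ifs at h <;> omega
    fin_cases b <;> fin_cases c <;> simp at h <;> split_ifs at h
  · exfalso
    fin_cases b <;> fin_cases c <;> simp at h <;> split_ifs at h <;> omega
  · exfalso
    obtain rfl : i = j := by
      fin_cases b <;> fin_cases c <;> simp at h ⊢ <;> split_ifs at h <;> omega
    fin_cases b <;> fin_cases c <;> simp at h <;> split_ifs at h
  · obtain rfl : i = j := by
      fin_cases b <;> fin_cases c <;> simp at h ⊢ <;> split_ifs at h <;> omega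
    fin_cases b <;> fin_cases c <;> simp at h ⊢
  · exfalso
    fin_cases b <;> fin_cases c <;> simp at h <;> split_ifs at h <;> omega
  · have : i = j := by
      split_ifs at h <;> simp at h <;> omega
    rw [this]
  · exfalso
    split_ifs at h <;> simp at h <;> omega
  · exfalso
    split_ifs at h <;> simp at h <;> omega
  · exfalso
    split_ifs at h <;> simp at h <;> omega
  · have : i = j := by
      simp only [Code.triple.injEq, decide_eq_decide] at h
      omega
    rw [this]
  · exfalso
    split_ifs at h <;> simp at h <;> omega
  · exfalso
    split_ifs at h <;> simp at h <;> omega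
  · exfalso
    split_ifs at h <;> simp at h <;> omega
  · have : i = j := by
      split_ifs at h <;> simp at h <;> omega
    rw [this]
  · exfalso
    fin_cases b <;> fin_cases c <;> simp at h <;> split_ifs at h <;> omega
  · exfalso
    fin_cases b <;> fin_cases c <;> simp at h <;> split_ifs at h <;> omega
  · obtain rfl : i = j := by
      fin_cases b <;> fin_cases c <;> simp at h ⊢ <;> omega
    fin_cases b <;> fin_cases c <;> simp at h ⊢
  · exfalso
    split_ifs at h <;> simp at h <;> omega
  · exfalso
    have := tripleIdx_lt hs' c
    simp only [tripleMid, Code.mid.injEq] at h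
    split_ifs at h <;> omega
  · have : i = j := by
      simp only [Code.mid.injEq] at h
      split_ifs at h <;> omega
    rw [this]

end Sizes

end LabelDesign

/-! ### Arithmetic of the labels. -/

section LabelSystem

namespace Sizes

variable {p : Sizes}

variable (p) in
/-- The label of a slot. -/
def label (sgn : ℕ → Bool) (s : Slot ℕ ℕ ℕ ℕ ℕ ℕ) : ℤ := (p.code sgn s).val p

theorem label_le_add_lt (sgn : ℕ → Bool) (i : ℕ) (b : Fin 2) :
    p.label sgn (.le i b) + p.label sgn (.lt i b) = p.C := by
  fin_cases b <;> simp [label, code, Code.val]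

theorem label_ke_add_kt (sgn : ℕ → Bool) (i : ℕ) :
    p.label sgn (.ke i) + p.label sgn (.kt i) = p.C := by
  simp only [label, code]
  split_ifs <;> simp [Code.val]

theorem label_kg (sgn : ℕ → Bool) (i : ℕ) :
    p.label sgn (.kg i) = p.label sgn (.ke i) + 1 := by
  simp only [label, code]
  split_ifs with h
  · simp [Code.val, h]; ring
  · simp [Code.val, Nat.mod_two_ne_zero.1 h]; ring

theorem label_ch (sgn : ℕ → Bool) (i : ℕ) :
    p.label sgn (.ch i 0) + p.label sgn (.ch i 1) = p.C := by
  simp [label, code, Code.val]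

/-- There are 14 free labels before 15 and 4 between consecutive spaced ones. Both numbers are even,
so the `unit` labels `2 * i` and `2 * i + 1` are consecutive integers; `sgn` decides which of the
two is complemented. -/
theorem label_le (sgn : ℕ → Bool) (i : ℕ) :
    p.label sgn (.le i 0) + p.label sgn (.le i 1) = p.C + if sgn i then 1 else -1 := by
  have h : p.unitPos (2 * i + 1) = p.unitPos (2 * i) + 1 := by
    simp only [unitPos]
    omega
  simp only [label, code, Code.val]
  split_ifs <;> simp_all <;> ring

/-- As `nT, nK ≤ nR`, `le_sum` forces `2 * nL + nC ≥ 9 * nR`: the low block has ample room for the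
spaced labels. -/
theorem mid_bounds (hp : p.Admissible) : 150 ≤ p.P0 ∧ 10 + 5 * p.nR < p.P0 ∧
    p.P0 < p.a ∧ 2 * (p.P0 : ℤ) < p.C ∧ 25 * (p.nR : ℤ) < p.C := by
  have hC := Code.C_eq (p := p)
  have ha := Code.a_eq (p := p)
  obtain ⟨h1, h2, h3, h4⟩ := hp
  simp only [P0, C] at *
  omega

theorem label_r_mid (sgn : ℕ → Bool) {i : ℕ} (h : ¬ i < 2 * (p.nR / 2)) (hi : i < p.nR) :
    |2 * p.label sgn (.r i) - p.C| ≤ 2 := by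
  have h1 : ¬ i < p.nR / 2 := by omega
  simp only [label, code, if_neg h1, if_neg h, Code.val]
  have hC := Code.C_eq (p := p)
  have ha := Code.a_eq (p := p)
  rw [abs_le]
  omega

theorem label_r_cases (sgn : ℕ → Bool) {i : ℕ} (hi : i < p.nR) :
    (i < p.nR / 2 ∧ p.label sgn (.r i) = 15 + 5 * i) ∨
    (p.nR / 2 ≤ i ∧ i < 2 * (p.nR / 2) ∧
      p.label sgn (.r i) = p.C - (15 + 5 * (i - p.nR / 2 : ℤ))) ∨
    (i = 2 * (p.nR / 2) ∧ |2 * p.label sgn (.r i) - p.C| ≤ 2) := by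
  by_cases h1 : i < p.nR / 2
  · left
    simp [label, code, h1, Code.val]
  · by_cases h2 : i < 2 * (p.nR / 2)
    · right; left
      simp only [label, code, h1, h2, Code.val, if_true, if_false]
      refine ⟨by omega, trivial, ?_⟩
      rw [Nat.cast_sub (by omega)]
      simp
    · exact Or.inr (Or.inr ⟨by omega, label_r_mid sgn h2 hi⟩)

theorem label_r_bounds (hp : p.Admissible) (sgn : ℕ → Bool) {i : ℕ} (hi : i < p.nR) :
    15 ≤ p.label sgn (.r i) ∧ p.label sgn (.r i) ≤ p.C - 15 := by
  have h := mid_bounds hp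
  rcases label_r_cases sgn hi with h1 | h1 | h1 <;> (try rw [abs_le] at h1) <;> omega

theorem label_r_sub (hp : p.Admissible) (sgn : ℕ → Bool) {i j : ℕ} (hi : i < p.nR)
    (hj : j < p.nR) (hij : i ≠ j) : 5 ≤ |p.label sgn (.r i) - p.label sgn (.r j)| := by
  have h := mid_bounds hp
  rw [le_abs]
  rcases label_r_cases sgn hi with h1 | h1 | h1 <;> rcases label_r_cases sgn hj with h2 | h2 | h2 <;>
    (try rw [abs_le] at h1) <;> (try rw [abs_le] at h2) <;> omega

/-- Two root labels can differ by about `C / 2` only if one is the middle label, and then the offset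
15 of the spaced labels keeps them off. -/
theorem label_r_odd (hp : p.Admissible) (sgn : ℕ → Bool) {i j : ℕ} (hi : i < p.nR)
    (hj : j < p.nR) : 10 ≤ |2 * (p.label sgn (.r i) - p.label sgn (.r j)) - p.C| := by
  have h := mid_bounds hp
  rw [le_abs]
  rcases label_r_cases sgn hi with h1 | h1 | h1 <;> rcases label_r_cases sgn hj with h2 | h2 | h2 <;>
    (try rw [abs_le] at h1) <;> (try rw [abs_le] at h2) <;> omega

/-- In `d`, one unit comes from the parity of the index and one from whether the second member lies
beyond the gap opened for the odd root label. -/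
theorem label_t_sum (sgn : ℕ → Bool) {i : ℕ} (hi : i < p.nT) :
    |2 * ∑ b, p.label sgn (.t i b) - 3 * p.C| ≤ 5 ∧ ∃ d : ℤ, 0 ≤ d ∧ d ≤ 2 ∧
      ∑ b, p.label sgn (.t i b) =
        (3 * p.a + 3 * (p.nY / 2) + 4 * p.nT + (p.nT + 1) / 2 + p.nR % 2 : ℕ) - 2 + d := by
  have hC := Code.C_eq (p := p)
  have ha := Code.a_eq (p := p)
  rw [abs_le]
  have key : ∑ b, p.label sgn (.t i b) = (3 * p.a + p.tripleMid (p.tripleIdx i 0) +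
      p.tripleMid (p.tripleIdx i 1) + p.tripleMid (p.tripleIdx i 2) : ℕ) := by
    simp only [Fin.sum_univ_three, label, code, Code.val]
    push_cast
    ring
  rw [key]
  simp only [tripleMid, tripleIdx]
  simp only [if_true, Fin.isValue, one_ne_zero, if_false, show (2 : Fin 3) ≠ 0 by decide,
    show (2 : Fin 3) ≠ 1 by decide]
  refine ⟨?_, _, ?_, ?_, (add_sub_cancel _ _).symm⟩ <;> split_ifs <;> omega

theorem label_t_sub (sgn : ℕ → Bool) {i j : ℕ} (hi : i < p.nT) (hj : j < p.nT) :
    |∑ b, p.label sgn (.t i b) - ∑ b, p.label sgn (.t j b)| ≤ 2 := by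
  obtain ⟨-, d, h1, h2, h3⟩ := label_t_sum sgn hi
  obtain ⟨-, d', h1', h2', h3'⟩ := label_t_sum sgn hj
  rw [h3, h3', abs_le]
  constructor <;> linarith

theorem label_y (sgn : ℕ → Bool) : ∃ g : ℕ → ℤ, Monotone g ∧ (∀ i, 0 ≤ g i) ∧
    ∀ i, p.label sgn (.y i) = g i := by
  refine ⟨fun i => p.label sgn (.y i), ?_, ?_, fun i => rfl⟩
  · intro i j hij
    simp only [label, code, Code.val]
    split_ifs <;> push_cast <;> omega
  · intro i
    simp only [label, code, Code.val]
    positivity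

end Sizes

/-- Reindexing of slots. -/
def Slot.map {R T L K N Y R' T' L' K' N' Y' : Type*} (fR : R → R') (fT : T → T') (fL : L → L')
    (fK : K → K') (fN : N → N') (fY : Y → Y') : Slot R T L K N Y → Slot R' T' L' K' N' Y'
  | .r i => .r (fR i)
  | .t i b => .t (fT i) b
  | .le i b => .le (fL i) b
  | .lt i b => .lt (fL i) b
  | .ke i => .ke (fK i)
  | .kg i => .kg (fK i)
  | .kt i => .kt (fK i)
  | .ch i b => .ch (fN i) b
  | .y i => .y (fY i)

theorem Slot.map_injective {R T L K N Y R' T' L' K' N' Y' : Type*} {fR : R → R'} {fT : T → T'}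
    {fL : L → L'} {fK : K → K'} {fN : N → N'} {fY : Y → Y'} (hR : Function.Injective fR)
    (hT : Function.Injective fT) (hL : Function.Injective fL) (hK : Function.Injective fK)
    (hN : Function.Injective fN) (hY : Function.Injective fY) :
    Function.Injective (Slot.map fR fT fL fK fN fY) := by
  intro s s' h
  cases s <;> cases s' <;> simp only [Slot.map, Slot.r.injEq, Slot.t.injEq, Slot.le.injEq,
    Slot.lt.injEq, Slot.ke.injEq, Slot.kg.injEq, Slot.kt.injEq, Slot.ch.injEq, Slot.y.injEq,
    reduceCtorEq, hR.eq_iff, hT.eq_iff, hL.eq_iff, hK.eq_iff, hN.eq_iff, hY.eq_iff] at h ⊢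
  all_goals exact h

/-- A labelling of slots by `1, …, m` with the complementarity properties used in the
construction. -/
structure IsLabeling {R T L K N : Type*} {n : ℕ} (sgn : L → Bool) (m : ℤ)
    (lab : Slot R T L K N (Fin n) → ℤ) : Prop where
  injective : Function.Injective lab
  one_le : ∀ s, 1 ≤ lab s
  le_m : ∀ s, lab s ≤ m
  le_add_lt : ∀ i b, lab (.le i b) + lab (.lt i b) = m + 1
  ke_add_kt : ∀ i, lab (.ke i) + lab (.kt i) = m + 1
  kg_eq : ∀ i, lab (.kg i) = lab (.ke i) + 1
  ch_add : ∀ i, lab (.ch i 0) + lab (.ch i 1) = m + 1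
  le_add : ∀ i, lab (.le i 0) + lab (.le i 1) = m + 1 + if sgn i then 1 else -1
  r_ge : ∀ i, 15 ≤ lab (.r i)
  r_le : ∀ i, lab (.r i) ≤ m - 14
  r_sub : ∀ i j, i ≠ j → 5 ≤ |lab (.r i) - lab (.r j)|
  r_odd : ∀ i j, 10 ≤ |2 * (lab (.r i) - lab (.r j)) - (m + 1)|
  t_sum : ∀ i, |2 * ∑ b, lab (.t i b) - 3 * (m + 1)| ≤ 5
  t_sub : ∀ i j, |∑ b, lab (.t i b) - ∑ b, lab (.t j b)| ≤ 2
  exists_y : ∃ g : ℕ → ℤ, Monotone g ∧ (∀ i, 0 ≤ g i) ∧ ∀ i : Fin n, lab (.y i) = g i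

open Fintype in
theorem exists_isLabeling {R T L K N : Type*} [Fintype R] [Fintype T] [Fintype L] [Fintype K]
    [Fintype N] (n : ℕ) (sgn : L → Bool) (hT : card T ≤ card R) (hK : card K ≤ card R)
    (hR : 17 ≤ card R)
    (h : 25 * card R ≤ card R + 3 * card T + 4 * card L + 3 * card K + 2 * card N) :
    ∃ lab : Slot R T L K N (Fin n) → ℤ, IsLabeling sgn
      (card R + 3 * card T + 4 * card L + 3 * card K + 2 * card N + n : ℕ) lab := by
  let p : Sizes := ⟨card R, card T, card L, card K, card N, n⟩
  have hp : p.Admissible := ⟨hT, hK, hR, h⟩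
  let sg : ℕ → Bool := fun i => if h : i < card L then sgn ((equivFin L).symm ⟨i, h⟩) else true
  have hsg (i : L) : sg (equivFin L i) = sgn i := by simp [sg]
  let f : Slot R T L K N (Fin n) → Slot ℕ ℕ ℕ ℕ ℕ ℕ := Slot.map (fun i => equivFin R i)
    (fun i => equivFin T i) (fun i => equivFin L i) (fun i => equivFin K i)
    (fun i => equivFin N i) (fun i => i)
  have hf : Function.Injective f := by
    apply Slot.map_injective <;> intro i j hij
    all_goals simpa [Fin.val_inj] using hij
  have hfu (s) : p.Used (f s) := by
    cases s <;> exact Fin.isLt _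
  have hC : ((card R + 3 * card T + 4 * card L + 3 * card K + 2 * card N + n : ℕ) : ℤ) + 1
      = p.C := by
    simp [Sizes.C, p]
  refine ⟨fun s => p.label sg (f s), ?_⟩
  have hm : ∀ s, 1 ≤ p.label sg (f s) ∧ p.label sg (f s) ≤ p.C - 1 :=
    fun s => Code.val_mem hp (Sizes.code_valid sg (hfu s))
  constructor
  · intro s s' hss
    exact hf (Sizes.code_injective sg (hfu s) (hfu s') (Code.val_injective hp
      (Sizes.code_valid sg (hfu s)) (Sizes.code_valid sg (hfu s')) hss))
  · exact fun s => (hm s).1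
  · intro s
    have := (hm s).2
    linarith
  · intro i b
    rw [hC]
    exact Sizes.label_le_add_lt sg _ b
  · intro i
    rw [hC]
    exact Sizes.label_ke_add_kt sg _
  · intro i
    exact Sizes.label_kg sg _
  · intro i
    rw [hC]
    exact Sizes.label_ch sg _
  · intro i
    rw [hC, ← hsg]
    exact Sizes.label_le sg _
  · intro i
    exact (Sizes.label_r_bounds hp sg (Fin.isLt (equivFin R i))).1
  · intro i
    have := (Sizes.label_r_bounds hp sg (Fin.isLt (equivFin R i))).2
    dsimp only [f, Slot.map]
    linarith
  · intro i j hij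
    exact Sizes.label_r_sub hp sg (Fin.isLt (equivFin R i)) (Fin.isLt (equivFin R j))
      (by simpa [Fin.val_inj] using hij)
  · intro i j
    rw [hC]
    exact Sizes.label_r_odd hp sg (Fin.isLt (equivFin R i)) (Fin.isLt (equivFin R j))
  · intro i
    rw [hC]
    exact (Sizes.label_t_sum sg (Fin.isLt (equivFin T i))).1
  · intro i j
    exact Sizes.label_t_sub sg (Fin.isLt (equivFin T i)) (Fin.isLt (equivFin T j))
  · obtain ⟨g, h1, h2, h3⟩ := Sizes.label_y (p := p) sg
    exact ⟨g, h1, h2, fun i => h3 i⟩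

end LabelSystem

/-! ### Frames: assigning roles to the arcs. -/

section Arcs

namespace Slot

variable {R T L K N Y : Type*}

/-- Slots as a sum type. -/
def equivSum : Slot R T L K N Y ≃
    R ⊕ (T × Fin 3) ⊕ (L × Fin 2) ⊕ (L × Fin 2) ⊕ K ⊕ K ⊕ K ⊕ (N × Fin 2) ⊕ Y where
  toFun
    | .r i => .inl i
    | .t i b => .inr (.inl (i, b))
    | .le i b => .inr (.inr (.inl (i, b)))
    | .lt i b => .inr (.inr (.inr (.inl (i, b))))
    | .ke i => .inr (.inr (.inr (.inr (.inl i))))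
    | .kg i => .inr (.inr (.inr (.inr (.inr (.inl i)))))
    | .kt i => .inr (.inr (.inr (.inr (.inr (.inr (.inl i))))))
    | .ch i b => .inr (.inr (.inr (.inr (.inr (.inr (.inr (.inl (i, b))))))))
    | .y i => .inr (.inr (.inr (.inr (.inr (.inr (.inr (.inr i)))))))
  invFun
    | .inl i => .r i
    | .inr (.inl (i, b)) => .t i b
    | .inr (.inr (.inl (i, b))) => .le i b
    | .inr (.inr (.inr (.inl (i, b)))) => .lt i b
    | .inr (.inr (.inr (.inr (.inl i)))) => .ke i
    | .inr (.inr (.inr (.inr (.inr (.inl i))))) => .kg i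
    | .inr (.inr (.inr (.inr (.inr (.inr (.inl i)))))) => .kt i
    | .inr (.inr (.inr (.inr (.inr (.inr (.inr (.inl (i, b)))))))) => .ch i b
    | .inr (.inr (.inr (.inr (.inr (.inr (.inr (.inr i))))))) => .y i
  left_inv s := by cases s <;> rfl
  right_inv s := by
    rcases s with i | ⟨i, b⟩ | ⟨i, b⟩ | ⟨i, b⟩ | i | i | i | ⟨i, b⟩ | i <;> rfl

instance [Fintype R] [Fintype T] [Fintype L] [Fintype K] [Fintype N] [Fintype Y] :
    Fintype (Slot R T L K N Y) := Fintype.ofEquiv _ equivSum.symm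

variable [Fintype R] [Fintype T] [Fintype L] [Fintype K] [Fintype N] [Fintype Y]

theorem sum_eq (f : Slot R T L K N Y → ℤ) : ∑ s, f s = ∑ i, f (.r i) + ∑ i, ∑ b, f (.t i b) +
    ∑ i, ∑ b, f (.le i b) + ∑ i, ∑ b, f (.lt i b) + ∑ i, f (.ke i) + ∑ i, f (.kg i) +
    ∑ i, f (.kt i) + ∑ i, ∑ b, f (.ch i b) + ∑ i, f (.y i) := by
  rw [← equivSum.symm.sum_comp]
  simp only [Fintype.sum_sum_type, Fintype.sum_prod_type]
  simp only [equivSum, Equiv.coe_fn_symm_mk]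
  ring

theorem card_eq : Fintype.card (Slot R T L K N Y) = Fintype.card R + 3 * Fintype.card T +
    4 * Fintype.card L + 3 * Fintype.card K + 2 * Fintype.card N + Fintype.card Y := by
  rw [Fintype.card_congr equivSum]
  simp only [Fintype.card_sum, Fintype.card_prod, Fintype.card_fin]
  ring

end Slot

variable {V : Type*}

open Classical in
/-- The combinatorial data of the construction, except for the edges outside `X`: the arcs go from
`X` to its complement, and inside `X` they are given by `O`. The neighbours outside `X` of a vertex
`x` of `X` play the roles listed in the type of `φ`, and its in-neighbours inside `X` those listed
in the type of `χ`. -/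
structure Frame (G : SimpleGraph V) where
  X : Finset V
  O : X → X → Prop
  O_adj : ∀ u v : X, G.Adj u v ↔ O u v ∨ O v u
  O_asymm : ∀ u v, O u v → ¬ O v u
  e : X → ℕ
  o : X → ℕ
  l : X → ℕ
  c : X → ℕ
  e_le : ∀ x, e x ≤ 1
  o_le : ∀ x, o x ≤ 1
  -- Out-degree plus `c - l` is the multiple of `C` in the sum at `x`; without a triple it must be
  -- positive to bring the sum below `-C`.
  lt_of_e_eq_zero : ∀ x, e x = 0 → l x < Fintype.card {v // O x v} + c x
  le_of_e_eq_one : ∀ x, e x = 1 → l x ≤ Fintype.card {v // O x v} + c x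
  -- Summed over `x`, with total out-degree equal to total in-degree, this is twice
  -- `Sizes.Admissible.le_sum`.
  count : ∀ x, 50 ≤ 2 + 6 * e x + 3 * Fintype.card {v // O x v} + 3 * o x + 4 * c x + 2 * l x
  card_X : 17 ≤ Fintype.card X
  φ : ∀ x : X, Unit ⊕ (Fin (e x) × Fin 3) ⊕ {v // O x v} ⊕ Fin (o x) ⊕ (Fin (c x) × Fin 2) ≃
    {y // y ∉ X ∧ G.Adj x y}
  χ : ∀ x : X, (Fin (l x) × Fin 2) ⊕ Fin (o x) ≃ {u // O u x}
  M : {y // y ∉ X} → X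
  M_inj : Function.Injective M
  φ_M : ∀ y, ((φ (M y) (.inl ())) : V) = y

namespace Frame

variable {G : SimpleGraph V} (F : Frame G)

/-- The slots of a frame together with `n` edges outside `X`. -/
abbrev Slots (n : ℕ) := Slot F.X (Σ x, Fin (F.e x)) (Σ x, Fin (F.l x)) (Σ x, Fin (F.o x))
  (Σ x, Fin (F.c x)) (Fin n)

/-- The in-neighbour of `x` with a given role. -/
def src (x : F.X) (s : (Fin (F.l x) × Fin 2) ⊕ Fin (F.o x)) : F.X := (F.χ x s).1

theorem src_O (x : F.X) (s : (Fin (F.l x) × Fin 2) ⊕ Fin (F.o x)) : F.O (F.src x s) x :=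
  (F.χ x s).2

/-- The neighbour of `x` outside `X` in the role of a companion of the arc from `x` to `v`. -/
def thin {x v : F.X} (h : F.O x v) : V := (F.φ x (.inr (.inr (.inl ⟨v, h⟩)))).1

variable {n : ℕ} (arc : Fin n → V × V)

/-- The arc of a slot. -/
def slotArc : F.Slots n → V × V
  | .r x => (x, F.φ x (.inl ()))
  | .t x b => (x.1, F.φ x.1 (.inr (.inl (x.2, b))))
  | .le x b => (F.src x.1 (.inl (x.2, b)), x.1)
  | .lt x b => (F.src x.1 (.inl (x.2, b)), F.thin (F.src_O x.1 (.inl (x.2, b))))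
  | .ke x => (F.src x.1 (.inr x.2), x.1)
  | .kg x => (x.1, F.φ x.1 (.inr (.inr (.inr (.inl x.2)))))
  | .kt x => (F.src x.1 (.inr x.2), F.thin (F.src_O x.1 (.inr x.2)))
  | .ch x b => (x.1, F.φ x.1 (.inr (.inr (.inr (.inr (x.2, b))))))
  | .y i => arc i

/-- The digraph of a frame and a family of arcs outside `X`. -/
def digraph : Digraph V where
  Adj u v := (u ∈ F.X ∧ v ∉ F.X ∧ G.Adj u v) ∨ (∃ (hu : u ∈ F.X) (hv : v ∈ F.X),
    F.O ⟨u, hu⟩ ⟨v, hv⟩) ∨ ∃ i, arc i = (u, v)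

/-- The arcs orient the edges outside `X`. -/
structure IsArcs : Prop where
  notMem_left : ∀ i, (arc i).1 ∉ F.X
  notMem_right : ∀ i, (arc i).2 ∉ F.X
  adj : ∀ i, G.Adj (arc i).1 (arc i).2
  injective : Function.Injective fun i => s((arc i).1, (arc i).2)
  surjective : ∀ u v, u ∉ F.X → v ∉ F.X → G.Adj u v → ∃ i, s((arc i).1, (arc i).2) = s(u, v)

variable {F arc}

theorem isOrientation (h : F.IsArcs arc) : IsOrientation G (F.digraph arc) := by
  constructor
  · intro u v
    by_cases hu : u ∈ F.X <;> by_cases hv : v ∈ F.X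
    · have h1 : ∀ i, arc i ≠ (u, v) := fun i hi => h.notMem_left i (by rwa [hi])
      have h2 : ∀ i, arc i ≠ (v, u) := fun i hi => h.notMem_left i (by rwa [hi])
      simpa [digraph, hu, hv, h1, h2] using F.O_adj ⟨u, hu⟩ ⟨v, hv⟩
    · have h1 : ∀ i, arc i ≠ (u, v) := fun i hi => h.notMem_left i (by rwa [hi])
      have h2 : ∀ i, arc i ≠ (v, u) := fun i hi => h.notMem_right i (by rwa [hi])
      simp [digraph, hu, hv, h1, h2]
    · have h1 : ∀ i, arc i ≠ (u, v) := fun i hi => h.notMem_right i (by rwa [hi])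
      have h2 : ∀ i, arc i ≠ (v, u) := fun i hi => h.notMem_left i (by rwa [hi])
      simp [digraph, hu, hv, h1, h2, G.adj_comm]
    · simp only [digraph, hu, hv, false_and, not_false_eq_true, true_and, false_or,
        IsEmpty.exists_iff]
      constructor
      · intro huv
        obtain ⟨i, hi⟩ := h.surjective u v hu hv huv
        rcases Sym2.eq_iff.1 hi with ⟨h1, h2⟩ | ⟨h1, h2⟩
        · exact Or.inl ⟨i, Prod.ext h1 h2⟩
        · exact Or.inr ⟨i, Prod.ext h1 h2⟩
      · rintro (⟨i, hi⟩ | ⟨i, hi⟩)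
        · have := h.adj i; rwa [hi] at this
        · have := h.adj i; rw [hi] at this; exact this.symm
  · rintro u v (⟨hu, hv, -⟩ | ⟨hu, hv, huv⟩ | ⟨i, hi⟩) (⟨hv', hu', -⟩ | ⟨hv', hu', hvu⟩ | ⟨j, hj⟩)
    · exact hv hv'
    · exact hv hv'
    · exact (h.notMem_right j) (by rwa [hj])
    · exact hu' hu
    · exact F.O_asymm _ _ huv hvu
    · exact (h.notMem_right j) (by rwa [hj])
    · exact (h.notMem_right i) (by rwa [hi])
    · exact (h.notMem_right i) (by rwa [hi])
    · have : i = j := h.injective (by simp [hi, hj, Sym2.eq_swap])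
      subst this
      have hh := h.adj i
      rw [hi] at hj
      rw [hi] at hh
      exact hh.ne (Prod.ext_iff.1 hj).1

theorem src_symm {x u : F.X} (h : F.O u x) : F.src x ((F.χ x).symm ⟨u, h⟩) = u := by
  simp [src]

theorem slotArc_adj (s : F.Slots n) : (F.digraph arc).Adj (F.slotArc arc s).1 (F.slotArc arc s).2 := by
  cases s with
  | r x => exact Or.inl ⟨x.2, (F.φ x _).2⟩
  | t x b => exact Or.inl ⟨x.1.2, (F.φ x.1 _).2⟩
  | le x b => exact Or.inr (Or.inl ⟨(F.src x.1 _).2, x.1.2, F.src_O x.1 _⟩)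
  | lt x b => exact Or.inl ⟨(F.src x.1 _).2, (F.φ _ _).2⟩
  | ke x => exact Or.inr (Or.inl ⟨(F.src x.1 _).2, x.1.2, F.src_O x.1 _⟩)
  | kg x => exact Or.inl ⟨x.1.2, (F.φ x.1 _).2⟩
  | kt x => exact Or.inl ⟨(F.src x.1 _).2, (F.φ _ _).2⟩
  | ch x b => exact Or.inl ⟨x.1.2, (F.φ x.1 _).2⟩
  | y i => exact Or.inr (Or.inr ⟨i, rfl⟩)

theorem exists_src {x u : F.X} (h : F.O u x) : ∃ s, F.src x s = u := ⟨_, src_symm h⟩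

theorem exists_slotArc {u v : V} (h : (F.digraph arc).Adj u v) : ∃ s, F.slotArc arc s = (u, v) := by
  rcases h with ⟨hu, hv, huv⟩ | ⟨hu, hv, huv⟩ | ⟨i, hi⟩
  · have hr : ((F.φ ⟨u, hu⟩ ((F.φ ⟨u, hu⟩).symm ⟨v, hv, huv⟩)) : V) = v := by simp
    generalize (F.φ ⟨u, hu⟩).symm ⟨v, hv, huv⟩ = r at hr
    rcases r with _ | ⟨i, b⟩ | ⟨w, hw⟩ | i | ⟨i, b⟩
    · exact ⟨.r ⟨u, hu⟩, Prod.ext rfl hr⟩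
    · exact ⟨.t ⟨⟨u, hu⟩, i⟩ b, Prod.ext rfl hr⟩
    · obtain ⟨s, hs⟩ := exists_src hw
      have key : ((F.src w s : V), F.thin (F.src_O w s)) = (u, v) := by
        have : ∀ (z : F.X) (hz : F.O z w), z = ⟨u, hu⟩ → ((z : V), F.thin hz) = (u, v) := by
          rintro z hz rfl
          exact Prod.ext rfl hr
        exact this _ _ hs
      rcases s with ⟨i, b⟩ | i
      · exact ⟨.lt ⟨w, i⟩ b, key⟩
      · exact ⟨.kt ⟨w, i⟩, key⟩
    · exact ⟨.kg ⟨⟨u, hu⟩, i⟩, Prod.ext rfl hr⟩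
    · exact ⟨.ch ⟨⟨u, hu⟩, i⟩ b, Prod.ext rfl hr⟩
  · obtain ⟨s, hs⟩ := exists_src huv
    rcases s with ⟨i, b⟩ | i
    · exact ⟨.le ⟨⟨v, hv⟩, i⟩ b, Prod.ext (congrArg Subtype.val hs) rfl⟩
    · exact ⟨.ke ⟨⟨v, hv⟩, i⟩, Prod.ext (congrArg Subtype.val hs) rfl⟩
  · exact ⟨.y i, hi⟩

-- The proof builds a left inverse: the ends of an arc determine its role, a companion being decoded
-- through the head of the inner arc it accompanies.
open Classical in
theorem slotArc_injective (h : F.IsArcs arc) : Function.Injective (F.slotArc arc) := by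
  let dec : (Σ x, Unit ⊕ (Fin (F.e x) × Fin 3) ⊕ {v // F.O x v} ⊕ Fin (F.o x) ⊕
      (Fin (F.c x) × Fin 2)) → F.Slots n := fun p => match p with
    | ⟨x, .inl _⟩ => .r x
    | ⟨x, .inr (.inl (i, b))⟩ => .t ⟨x, i⟩ b
    | ⟨x, .inr (.inr (.inl v))⟩ => Sum.elim (fun q => .lt ⟨v.1, q.1⟩ q.2) (fun i => .kt ⟨v.1, i⟩)
        ((F.χ v.1).symm ⟨x, v.2⟩)
    | ⟨x, .inr (.inr (.inr (.inl i)))⟩ => .kg ⟨x, i⟩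
    | ⟨x, .inr (.inr (.inr (.inr (i, b))))⟩ => .ch ⟨x, i⟩ b
  let inv : V × V → Option (F.Slots n) := fun a =>
    if hx : a.1 ∈ F.X then
      if hy : a.2 ∈ F.X then
        if ho : F.O ⟨a.1, hx⟩ ⟨a.2, hy⟩ then
          some (Sum.elim (fun q => .le ⟨⟨a.2, hy⟩, q.1⟩ q.2) (fun i => .ke ⟨⟨a.2, hy⟩, i⟩)
            ((F.χ ⟨a.2, hy⟩).symm ⟨⟨a.1, hx⟩, ho⟩))
        else none
      else if ha : G.Adj a.1 a.2 then
        some (dec ⟨⟨a.1, hx⟩, (F.φ ⟨a.1, hx⟩).symm ⟨a.2, hy, ha⟩⟩)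
      else none
    else if ha : ∃ i, arc i = a then some (.y ha.choose) else none
  have hφ (x : F.X) (r) : inv (x, F.φ x r) = some (dec ⟨x, r⟩) := by
    have := (F.φ x r).2
    simp [inv, this.1, this.2]
  have hχ (x : F.X) (r) : inv (F.src x r, x) = some (Sum.elim (fun q => .le ⟨x, q.1⟩ q.2)
      (fun i => .ke ⟨x, i⟩) r) := by
    have := F.src_O x r
    simp only [inv, Subtype.coe_eta, dite_true, this]
    simp [src]
  have hth (x : F.X) (r) : inv (F.src x r, F.thin (F.src_O x r)) = some (Sum.elim
      (fun q => .lt ⟨x, q.1⟩ q.2) (fun i => .kt ⟨x, i⟩) r) := by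
    rw [thin, hφ]
    simp [dec, src]
  have : ∀ s, inv (F.slotArc arc s) = some s := by
    intro s
    cases s with
    | r x => exact hφ x _
    | t x b => exact hφ x.1 _
    | le x b => exact hχ x.1 _
    | lt x b => exact hth x.1 _
    | ke x => exact hχ x.1 _
    | kg x => exact hφ x.1 _
    | kt x => exact hth x.1 _
    | ch x b => exact hφ x.1 _
    | y i =>
      have ha : ∃ j, arc j = arc i := ⟨i, rfl⟩
      have hi : ha.choose = i := h.injective (by simp [ha.choose_spec])
      simp [inv, slotArc, h.notMem_left i, hi]
  intro s s' hss
  have h1 := this s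
  rw [hss, this s'] at h1
  exact (Option.some.inj h1).symm

end Frame

end Arcs

/-! ### Formulas for the vertex sums. -/

section VertexSums

/-- Adding the values of an injective function in a suitable order makes any function
injective. -/
theorem exists_perm_add_injective {B : Type*} [Fintype B] (t g : B → ℤ)
    (hg : Function.Injective g) :
    ∃ π : Equiv.Perm B, Function.Injective fun y => t y + g (π y) := by
  classical
  -- If two values agreed at this maximum, swapping them would raise the sum by the square of `g (π
  -- y') - g (π y)`.
  obtain ⟨π, -, hπ⟩ := exists_max_image (univ : Finset (Equiv.Perm B))
    (fun π => ∑ y, t y * g (π y)) ⟨1, mem_univ _⟩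
  refine ⟨π, fun y y' h => ?_⟩
  by_contra hne
  have h1 := hπ (π * Equiv.swap y y') (mem_univ _)
  have h2 : ∑ z, (t z * g ((π * Equiv.swap y y') z) - t z * g (π z)) =
      (t y * g (π y') - t y * g (π y)) + (t y' * g (π y) - t y' * g (π y')) := by
    rw [Fintype.sum_eq_add y y' hne]
    · simp
    · rintro z ⟨hz, hz'⟩
      simp [Equiv.swap_apply_of_ne_of_ne hz hz']
  rw [sum_sub_distrib] at h2
  have h3 : g (π y') - g (π y) ≠ 0 := fun h0 =>
    hne (π.injective (hg (sub_eq_zero.1 h0).symm))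
  have h4 : 0 < (g (π y') - g (π y)) ^ 2 := by positivity
  have h5 : t y - t y' = g (π y') - g (π y) := by
    dsimp only at h
    linarith
  have h6 : (t y * g (π y') - t y * g (π y)) + (t y' * g (π y) - t y' * g (π y')) =
      (t y - t y') * (g (π y') - g (π y)) := by ring
  rw [h6, h5] at h2
  nlinarith

theorem sum_sigma_ite {A : Type*} [Fintype A] [DecidableEq A] {F : A → Type*}
    [∀ a, Fintype (F a)] (a : A) (f : (Σ a, F a) → ℤ) :
    (∑ p : Σ a, F a, if a = p.1 then f p else 0) = ∑ i, f ⟨a, i⟩ := by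
  rw [Fintype.sum_sigma, Fintype.sum_eq_single a]
  · simp
  · intro b hb
    simp [hb.symm]

theorem sum_alternating (l : ℕ) : (∑ i : Fin l, if (i : ℕ) % 2 = 0 then (1 : ℤ) else -1) =
    (l % 2 : ℕ) := by
  rw [Fin.sum_univ_eq_sum_range (fun i => if i % 2 = 0 then (1 : ℤ) else -1)]
  induction l with
  | zero => simp
  | succ l ih =>
    rw [sum_range_succ, ih]
    split_ifs <;> omega

namespace IsLabeling

variable {R T L K N : Type*} {n : ℕ} {sgn : L → Bool} {m : ℤ}
  {lab : Slot R T L K N (Fin n) → ℤ}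

theorem comp_perm (h : IsLabeling sgn m lab) (ρ : Equiv.Perm R) :
    IsLabeling sgn m (lab ∘ Slot.map ρ id id id id id) where
  injective := h.injective.comp (Slot.map_injective ρ.injective Function.injective_id
    Function.injective_id Function.injective_id Function.injective_id Function.injective_id)
  one_le _ := h.one_le _
  le_m _ := h.le_m _
  le_add_lt := h.le_add_lt
  ke_add_kt := h.ke_add_kt
  kg_eq := h.kg_eq
  ch_add := h.ch_add
  le_add := h.le_add
  r_ge _ := h.r_ge _
  r_le _ := h.r_le _
  r_sub _ _ hij := h.r_sub _ _ (ρ.injective.ne hij)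
  r_odd _ _ := h.r_odd _ _
  t_sum := h.t_sum
  t_sub := h.t_sub
  exists_y := h.exists_y

end IsLabeling

variable {V : Type*} {G : SimpleGraph V}

namespace Frame

variable (F : Frame G) {n : ℕ} (arc : Fin n → V × V)

open Classical in
/-- The contribution to the vertex sum at `v` of an arc `a` with label `t`. -/
noncomputable def arcTerm (v : V) (a : V × V) (t : ℤ) : ℤ :=
  (if v = a.2 then t else 0) - if v = a.1 then t else 0

/-- The vertex sum at `v` of a labelling of the slots of a frame. -/
noncomputable def net (lab : F.Slots n → ℤ) (v : V) : ℤ :=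
  ∑ s, arcTerm v (F.slotArc arc s) (lab s)

variable {F arc}

theorem orientedSum_extend [Fintype V] (h : F.IsArcs arc) (lab : F.Slots n → ℤ) (v : V) :
    orientedSum (F.digraph arc) (Function.extend (F.slotArc arc) lab 0) v = F.net arc lab v := by
  classical
  have hinj := slotArc_injective h
  have hσ := hinj.extend_apply lab 0
  simp only [net, arcTerm]
  rw [sum_sub_distrib, orientedSum, ← sum_filter, ← sum_filter]
  congr 1
  · symm
    refine sum_bij (fun s _ => (F.slotArc arc s).1) ?_ ?_ ?_ ?_
    · intro s hs
      rw [(mem_filter.1 hs).2]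
      exact mem_filter.2 ⟨mem_univ _, slotArc_adj s⟩
    · intro s hs s' hs' hss
      exact hinj (Prod.ext hss ((mem_filter.1 hs).2.symm.trans (mem_filter.1 hs').2))
    · intro u hu
      obtain ⟨s, hs⟩ := exists_slotArc (mem_filter.1 hu).2
      exact ⟨s, mem_filter.2 ⟨mem_univ _, by rw [hs]⟩, by rw [hs]⟩
    · intro s hs
      rw [(mem_filter.1 hs).2]
      exact (hσ s).symm
  · symm
    refine sum_bij (fun s _ => (F.slotArc arc s).2) ?_ ?_ ?_ ?_
    · intro s hs
      rw [(mem_filter.1 hs).2]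
      exact mem_filter.2 ⟨mem_univ _, slotArc_adj s⟩
    · intro s hs s' hs' hss
      exact hinj (Prod.ext ((mem_filter.1 hs).2.symm.trans (mem_filter.1 hs').2) hss)
    · intro u hu
      obtain ⟨s, hs⟩ := exists_slotArc (mem_filter.1 hu).2
      exact ⟨s, mem_filter.2 ⟨mem_univ _, by rw [hs]⟩, by rw [hs]⟩
    · intro s hs
      rw [(mem_filter.1 hs).2]
      exact (hσ s).symm

theorem arcSet_eq : arcSet (F.digraph arc) = Set.range (F.slotArc arc) := by
  ext ⟨u, v⟩
  constructor
  · exact fun h => exists_slotArc h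
  · rintro ⟨s, hs⟩
    have := slotArc_adj (arc := arc) s
    rwa [hs] at this

theorem bijOn_extend (h : F.IsArcs arc) {lab : F.Slots n → ℤ} {m : ℕ}
    (hm : Fintype.card (F.Slots n) = m) (hlab : Function.Injective lab)
    (h1 : ∀ s, 1 ≤ lab s) (h2 : ∀ s, lab s ≤ m) :
    Set.BijOn (Function.extend (F.slotArc arc) lab 0) (arcSet (F.digraph arc))
      (Set.Icc 1 ((arcSet (F.digraph arc)).ncard : ℤ)) := by
  have hinj := slotArc_injective h
  have hσ := hinj.extend_apply lab 0
  have hcard : (arcSet (F.digraph arc)).ncard = m := by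
    rw [arcSet_eq, ← Set.image_univ, Set.ncard_image_of_injective _ hinj, Set.ncard_univ,
      Nat.card_eq_fintype_card, hm]
  have hmaps : Set.MapsTo (Function.extend (F.slotArc arc) lab 0) (arcSet (F.digraph arc))
      (Set.Icc 1 ((arcSet (F.digraph arc)).ncard : ℤ)) := by
    rw [arcSet_eq]
    rintro _ ⟨s, rfl⟩
    rw [hσ, ← arcSet_eq, hcard]
    exact ⟨h1 s, h2 s⟩
  have hinjOn : Set.InjOn (Function.extend (F.slotArc arc) lab 0) (arcSet (F.digraph arc)) := by
    rw [arcSet_eq]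
    rintro _ ⟨s, rfl⟩ _ ⟨s', rfl⟩ hss
    rw [hσ, hσ] at hss
    rw [hlab hss]
  refine ⟨hmaps, hinjOn, ?_⟩
  have := Set.surj_on_of_inj_on_of_ncard_le (s := arcSet (F.digraph arc))
    (t := Set.Icc 1 ((arcSet (F.digraph arc)).ncard : ℤ))
    (fun a _ => Function.extend (F.slotArc arc) lab 0 a) (fun a ha => hmaps ha)
    (fun a b ha hb hab => hinjOn ha hb hab)
    (by rw [Set.ncard_eq_toFinset_card']; simp) (Set.finite_Icc _ _)
  intro b hb
  obtain ⟨a, ha, hab⟩ := this b hb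
  exact ⟨a, ha, hab.symm⟩

open Classical in
theorem sum_src (x : F.X) (C : ℤ) :
    (∑ p : Σ x, Fin (F.l x), ∑ b, if x = F.src p.1 (.inl (p.2, b)) then C else 0) +
      (∑ p : Σ x, Fin (F.o x), if x = F.src p.1 (.inr p.2) then C else 0) =
      C * Fintype.card {v // F.O x v} := by
  have h1 (x' : F.X) : (∑ r, if x = F.src x' r then C else 0) = if F.O x x' then C else 0 := by
    refine ((F.χ x').sum_comp fun u => if x = u.1 then C else 0).trans ?_
    by_cases h : F.O x x'
    · rw [Fintype.sum_eq_single ⟨x, h⟩]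
      · simp [h]
      · intro u hu
        rw [if_neg]
        rintro rfl
        exact hu rfl
    · rw [if_neg h]
      refine sum_eq_zero fun u _ => if_neg ?_
      rintro rfl
      exact h u.2
  rw [Fintype.sum_sigma, Fintype.sum_sigma, ← sum_add_distrib]
  calc _ = ∑ x', ∑ r, (if x = F.src x' r then C else 0) := by
        simp only [Fintype.sum_sum_type, Fintype.sum_prod_type]
    _ = ∑ x', if F.O x x' then C else 0 := sum_congr rfl fun x' _ => h1 x'
    _ = _ := by
      rw [← sum_filter, sum_const, Fintype.card_subtype, nsmul_eq_mul, mul_comm]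

-- Inner out-arcs with their companions, and `ch` pairs, give multiples of `m + 1`; `kg` cancels the
-- incoming `ke` up to 1.
open Classical in
theorem net_mem (h : F.IsArcs arc) {sgn : (Σ x, Fin (F.l x)) → Bool} {m : ℤ}
    {lab : F.Slots n → ℤ} (hlab : IsLabeling sgn m lab) (x : F.X) :
    F.net arc lab x = -(lab (.r x) + ∑ i, ∑ b, lab (.t ⟨x, i⟩ b) +
      (m + 1) * (F.c x + Fintype.card {v // F.O x v}) -
      ∑ i, ∑ b, lab (.le ⟨x, i⟩ b) + F.o x) := by
  have hφ (x') (r) : ¬ (x : V) = F.φ x' r := fun h => (F.φ x' r).2.1 (h ▸ x.2)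
  have hth {x' v} (h : F.O x' v) : ¬ (x : V) = F.thin h := hφ _ _
  have hl (i) : ¬ (x : V) = (arc i).1 := fun h' => h.notMem_left i (h' ▸ x.2)
  have hr (i) : ¬ (x : V) = (arc i).2 := fun h' => h.notMem_right i (h' ▸ x.2)
  rw [net, Slot.sum_eq]
  simp only [slotArc]
  simp only [arcTerm, hφ, hth, hl, hr, if_false, Subtype.coe_inj, zero_sub, sub_self, sum_sub_distrib,
    sum_neg_distrib]
  have h1 : (∑ i : F.X, if x = i then lab (.r i) else 0) = lab (.r x) := by simp
  have h2 : (∑ i : Σ x, Fin (F.e x), ∑ b, if x = i.1 then lab (.t i b) else 0) =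
      ∑ i, ∑ b, lab (.t ⟨x, i⟩ b) := by
    rw [← sum_sigma_ite x (fun i => ∑ b, lab (.t i b))]
    exact sum_congr rfl fun i _ => by split_ifs <;> simp
  have h3 : (∑ i : Σ x, Fin (F.l x), ∑ b, if x = i.1 then lab (.le i b) else 0) =
      ∑ i, ∑ b, lab (.le ⟨x, i⟩ b) := by
    rw [← sum_sigma_ite x (fun i => ∑ b, lab (.le i b))]
    exact sum_congr rfl fun i _ => by split_ifs <;> simp
  have h4 : (∑ i : Σ x, Fin (F.c x), ∑ b, if x = i.1 then lab (.ch i b) else 0) =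
      (m + 1) * F.c x := by
    have : (∑ i : Fin (F.c x), ∑ b, lab (.ch ⟨x, i⟩ b)) = (m + 1) * F.c x := by
      simp [Fin.sum_univ_two, hlab.ch_add, mul_comm]
    rw [← this, ← sum_sigma_ite x (fun i => ∑ b, lab (.ch i b))]
    exact sum_congr rfl fun i _ => by split_ifs <;> simp
  have h5 : (∑ i : Σ x, Fin (F.o x), if x = i.1 then lab (.ke i) else 0) =
      ∑ i, lab (.ke ⟨x, i⟩) := sum_sigma_ite x (fun i => lab (.ke i))
  have h6 : (∑ i : Σ x, Fin (F.o x), if x = i.1 then lab (.kg i) else 0) =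
      ∑ i, lab (.ke ⟨x, i⟩) + F.o x := by
    rw [sum_sigma_ite x (fun i => lab (.kg i))]
    simp [hlab.kg_eq, sum_add_distrib]
  have h7 := F.sum_src x (m + 1)
  have h8 : (∑ i : Σ x, Fin (F.l x), ∑ b,
        if x = F.src i.1 (.inl (i.2, b)) then m + 1 else 0) =
      (∑ i : Σ x, Fin (F.l x), ∑ b,
        if x = F.src i.1 (.inl (i.2, b)) then lab (.le i b) else 0) +
      ∑ i : Σ x, Fin (F.l x), ∑ b,
        if x = F.src i.1 (.inl (i.2, b)) then lab (.lt i b) else 0 := by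
    simp only [← sum_add_distrib]
    refine sum_congr rfl fun i _ => sum_congr rfl fun b _ => ?_
    split_ifs
    · exact (hlab.le_add_lt i b).symm
    · simp
  have h9 : (∑ i : Σ x, Fin (F.o x), if x = F.src i.1 (.inr i.2) then m + 1 else 0) =
      (∑ i : Σ x, Fin (F.o x), if x = F.src i.1 (.inr i.2) then lab (.ke i) else 0) +
      ∑ i : Σ x, Fin (F.o x), if x = F.src i.1 (.inr i.2) then lab (.kt i) else 0 := by
    simp only [← sum_add_distrib]
    refine sum_congr rfl fun i _ => ?_
    split_ifs
    · exact (hlab.ke_add_kt i).symm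
    · simp
  rw [h1, h2, h3, h4, h5, h6]
  simp only [sum_const_zero]
  linarith

end Frame

end VertexSums

/-! ### Distinctness of the sums. -/

section FrameLabeling

variable {V : Type*} {G : SimpleGraph V}

namespace Frame

variable {F : Frame G} {n : ℕ} {arc : Fin n → V × V}

/-- Vertices outside the range of `M` may also have their root at `y`; `hρ` freezes their labels, so
only the matching edge at `y` changes. -/
theorem net_comp_perm (lab : F.Slots n → ℤ) (ρ : Equiv.Perm F.X)
    (hρ : ∀ x ∉ Set.range F.M, ρ x = x) (y : {y // y ∉ F.X}) :
    F.net arc (lab ∘ Slot.map ρ id id id id id) y =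
      F.net arc lab y - lab (.r (F.M y)) + lab (.r (ρ (F.M y))) := by
  classical
  have hX (x : F.X) : ¬ (y : V) = x := fun h => y.2 (h ▸ x.2)
  have key : (∑ x, if (y : V) = F.φ x (.inl ()) then lab (.r (ρ x)) - lab (.r x) else 0) =
      lab (.r (ρ (F.M y))) - lab (.r (F.M y)) := by
    rw [Fintype.sum_eq_single (F.M y)]
    · rw [if_pos (F.φ_M y).symm]
    · intro x hx
      split_ifs with hy
      · rw [hρ x, sub_self]
        rintro ⟨y', rfl⟩
        rw [F.φ_M] at hy
        exact hx (by rw [Subtype.ext hy])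
      · rfl
  have key2 : (∑ x, if (y : V) = F.φ x (.inl ()) then lab (.r (ρ x)) else 0) =
      (∑ x, if (y : V) = F.φ x (.inl ()) then lab (.r x) else 0) +
      (lab (.r (ρ (F.M y))) - lab (.r (F.M y))) := by
    rw [← key, ← sum_add_distrib]
    refine sum_congr rfl fun x _ => ?_
    split_ifs <;> simp
  rw [net, net, Slot.sum_eq, Slot.sum_eq]
  simp only [slotArc, Function.comp_apply, Slot.map, id]
  simp only [arcTerm, hX, if_false, sub_zero]
  rw [key2]
  ring

-- Arcs between the parts only enter `y`, and the matching edge alone adds at least 1 to the bound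
-- from inside `Y`.
open Classical in
theorem net_ge {m : ℤ} {lab : F.Slots n → ℤ} (hlab : ∀ s, 1 ≤ lab s)
    (hy : ∀ v, -m ≤ ∑ i, ((if v = (arc i).2 then lab (.y i) else 0) -
      if v = (arc i).1 then lab (.y i) else 0)) (y : {y // y ∉ F.X}) :
    -m + 1 ≤ F.net arc lab y := by
  have hX (x : F.X) : ¬ (y : V) = x := fun h => y.2 (h ▸ x.2)
  have h0 (P : Prop) [Decidable P] (s) : 0 ≤ if P then lab s else 0 := by
    split_ifs
    · exact zero_le_one.trans (hlab s)
    · exact le_rfl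
  rw [net, Slot.sum_eq]
  simp only [slotArc]
  simp only [arcTerm, hX, if_false, sub_zero, sum_const_zero]
  have h1 : 1 ≤ ∑ x, if (y : V) = F.φ x (.inl ()) then lab (.r x) else 0 := by
    refine le_trans ?_ (single_le_sum (fun x _ => h0 _ _) (mem_univ (F.M y)))
    rw [if_pos (F.φ_M y).symm]
    exact hlab _
  have h2 : 0 ≤ ∑ i : Σ x, Fin (F.e x), ∑ b,
      if (y : V) = F.φ i.1 (.inr (.inl (i.2, b))) then lab (.t i b) else 0 :=
    sum_nonneg fun i _ => sum_nonneg fun b _ => h0 _ _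
  have h3 : 0 ≤ ∑ i : Σ x, Fin (F.l x), ∑ b,
      if (y : V) = F.thin (F.src_O i.1 (.inl (i.2, b))) then lab (.lt i b) else 0 :=
    sum_nonneg fun i _ => sum_nonneg fun b _ => h0 _ _
  have h4 : 0 ≤ ∑ i : Σ x, Fin (F.o x),
      if (y : V) = F.φ i.1 (.inr (.inr (.inr (.inl i.2)))) then lab (.kg i) else 0 :=
    sum_nonneg fun i _ => h0 _ _
  have h5 : 0 ≤ ∑ i : Σ x, Fin (F.o x),
      if (y : V) = F.thin (F.src_O i.1 (.inr i.2)) then lab (.kt i) else 0 :=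
    sum_nonneg fun i _ => h0 _ _
  have h6 : 0 ≤ ∑ i : Σ x, Fin (F.c x), ∑ b,
      if (y : V) = F.φ i.1 (.inr (.inr (.inr (.inr (i.2, b))))) then lab (.ch i b) else 0 :=
    sum_nonneg fun i _ => sum_nonneg fun b _ => h0 _ _
  have h7 := hy y
  linarith

variable (F) in
/-- The alternating signs of the pairs of arcs entering a vertex. -/
def sgn (p : Σ x, Fin (F.l x)) : Bool := p.2.1 % 2 = 0

theorem exists_net_eq (h : F.IsArcs arc) {m : ℤ} {lab : F.Slots n → ℤ}
    (hlab : IsLabeling F.sgn m lab) (x : F.X) : ∃ Q T δ : ℤ,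
      F.net arc lab x = -(lab (.r x) + T + (m + 1) * Q + δ) ∧ |δ| ≤ 1 ∧ 0 ≤ Q ∧
        (T = 0 ∧ 1 ≤ Q ∨ ∃ i, T = ∑ b, lab (.t i b)) := by
  classical
  have hs : ∑ i, ∑ b, lab (.le ⟨x, i⟩ b) = F.l x * (m + 1) + (F.l x % 2 : ℕ) := by
    rw [← sum_alternating]
    simp only [Fin.sum_univ_two, hlab.le_add, sum_add_distrib, sum_const, card_univ,
      Fintype.card_fin, nsmul_eq_mul, sgn, decide_eq_true_eq]
    ring
  refine ⟨F.c x + Fintype.card {v // F.O x v} - F.l x, ∑ i, ∑ b, lab (.t ⟨x, i⟩ b),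
    F.o x - (F.l x % 2 : ℕ), ?_, ?_, ?_⟩
  · rw [net_mem h hlab, hs]
    ring
  · have := F.o_le x
    rw [abs_le]
    omega
  · have he := F.e_le x
    rcases Nat.le_one_iff_eq_zero_or_eq_one.1 he with he | he
    · have := F.lt_of_e_eq_zero x he
      have : IsEmpty (Fin (F.e x)) := by rw [he]; infer_instance
      refine ⟨by lia, Or.inl ⟨by simp, by lia⟩⟩
    · have := F.le_of_e_eq_one x he
      have i : Fin (F.e x) := ⟨0, by omega⟩
      have : Subsingleton (Fin (F.e x)) := by rw [he]; infer_instance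
      refine ⟨by lia, Or.inr ⟨⟨x, i⟩, ?_⟩⟩
      exact Fintype.sum_subsingleton _ i

theorem net_lt (h : F.IsArcs arc) {m : ℤ} (hm : 0 ≤ m) {lab : F.Slots n → ℤ}
    (hlab : IsLabeling F.sgn m lab) (x : F.X) : F.net arc lab x < -(m + 1) := by
  obtain ⟨Q, T, δ, hnet, hδ, hQ, hT⟩ := exists_net_eq h hlab x
  have hr := hlab.r_ge x
  rw [abs_le] at hδ
  rw [hnet]
  rcases hT with ⟨rfl, hQ1⟩ | ⟨i, rfl⟩
  · have : (m + 1) * 1 ≤ (m + 1) * Q := mul_le_mul_of_nonneg_left hQ1 (by linarith)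
    linarith
  · have hi := abs_le.1 (hlab.t_sum i)
    have : 0 ≤ (m + 1) * Q := by positivity
    linarith

theorem eq_of_mul_add_eq {C a Q Q' : ℤ} (ha : |a| < C) (h : C * Q + a = C * Q') : Q = Q' := by
  rw [abs_lt] at ha
  by_contra hne
  rcases lt_or_gt_of_ne hne with hlt | hlt
  · have : C * 1 ≤ C * (Q' - Q) := mul_le_mul_of_nonneg_left (by linarith) (by linarith)
    linarith
  · have : C * 1 ≤ C * (Q - Q') := mul_le_mul_of_nonneg_left (by linarith) (by linarith)
    linarith

theorem net_ne (h : F.IsArcs arc) {m : ℤ} {lab : F.Slots n → ℤ}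
    (hlab : IsLabeling F.sgn m lab) {x x' : F.X} (hx : x ≠ x') :
    F.net arc lab x ≠ F.net arc lab x' := by
  obtain ⟨Q, T, δ, hnet, hδ, hQ, hT⟩ := exists_net_eq h hlab x
  obtain ⟨Q', T', δ', hnet', hδ', hQ', hT'⟩ := exists_net_eq h hlab x'
  rw [hnet, hnet']
  intro heq
  have h1 := hlab.r_ge x
  have h2 := hlab.r_le x
  have h1' := hlab.r_ge x'
  have h2' := hlab.r_le x'
  have h3 := hlab.r_sub x x' hx
  have h4 := hlab.r_odd x x'
  have h5 := hlab.r_odd x' x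
  rw [abs_le] at hδ hδ'
  -- All errors total at most 4, below the spacing 5, and root labels keep away from `0` and `m +
  -- 1`, so there is no wrap-around.
  have same (hTT : |T - T'| ≤ 2) : False := by
    rw [abs_le] at hTT
    have hQQ : Q = Q' := eq_of_mul_add_eq (C := m + 1)
      (a := lab (.r x) - lab (.r x') + (T - T') + (δ - δ'))
      (by rw [abs_lt]; constructor <;> linarith) (by linarith)
    subst hQQ
    rw [le_abs] at h3
    rcases h3 with h3 | h3 <;> linarith
  -- A triple on one side only would force `2 * (r - r')` within 9 of `±(m + 1)`.
  have mixed {r r' S d : ℤ} {k : ℤ} (hr : 15 ≤ r) (hr1 : r ≤ m - 14) (hr' : 15 ≤ r')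
      (hr1' : r' ≤ m - 14) (ho : 10 ≤ |2 * (r - r') - (m + 1)|)
      (ho' : 10 ≤ |2 * (r' - r) - (m + 1)|) (hS : |2 * S - 3 * (m + 1)| ≤ 5) (hd : -2 ≤ d)
      (hd' : d ≤ 2) (he : r - r' + S + (m + 1) * k + d = 0) : False := by
    rw [abs_le] at hS
    have hk1 : -3 < k := by
      by_contra hk
      have : (m + 1) * k ≤ (m + 1) * (-3) := mul_le_mul_of_nonneg_left (by linarith) (by linarith)
      linarith
    have hk2 : k < 0 := by
      by_contra hk
      have : (m + 1) * 0 ≤ (m + 1) * k := mul_le_mul_of_nonneg_left (by linarith) (by linarith)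
      linarith
    have hk : k = -1 ∨ k = -2 := by omega
    rw [le_abs] at ho ho'
    rcases hk with rfl | rfl <;> rcases ho with ho | ho <;> rcases ho' with ho' | ho' <;> linarith
  rcases hT with ⟨rfl, -⟩ | ⟨i, rfl⟩ <;> rcases hT' with ⟨rfl, -⟩ | ⟨i', rfl⟩
  · exact same (by simp)
  · exact mixed (k := Q' - Q) (d := δ' - δ) h1' h2' h1 h2 h5 h4 (hlab.t_sum i') (by linarith)
      (by linarith) (by linarith)
  · exact mixed (k := Q - Q') (d := δ - δ') h1 h2 h1' h2' h4 h5 (hlab.t_sum i) (by linarith)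
      (by linarith) (by linarith)
  · exact same (hlab.t_sub i i')

variable (F)

open Classical in
theorem sum_card_out : ∑ x, Fintype.card {v // F.O x v} = ∑ x, (2 * F.l x + F.o x) := by
  have h1 (x : F.X) : 2 * F.l x + F.o x = Fintype.card {u // F.O u x} := by
    rw [← Fintype.card_congr (F.χ x)]
    simp [mul_comm]
  simp only [h1, ← Fintype.card_sigma]
  exact Fintype.card_congr ⟨fun p => ⟨p.2.1, p.1, p.2.2⟩, fun p => ⟨p.2.1, p.1, p.2.2⟩,
    fun _ => rfl, fun _ => rfl⟩

theorem exists_slot_labeling (n : ℕ) : ∃ lab : F.Slots n → ℤ,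
    IsLabeling F.sgn (Fintype.card (F.Slots n)) lab := by
  classical
  rw [Slot.card_eq, Fintype.card_fin]
  have hs {f : F.X → ℕ} (hf : ∀ x, f x ≤ 1) : ∑ x, f x ≤ Fintype.card F.X := by
    refine (sum_le_sum fun x _ => hf x).trans ?_
    simp
  refine exists_isLabeling n F.sgn ?_ ?_ F.card_X ?_
  · simpa using hs F.e_le
  · simpa using hs F.o_le
  · simp only [Fintype.card_sigma, Fintype.card_fin]
    have h1 := sum_le_sum fun x (_ : x ∈ univ) => F.count x
    have h2 := F.sum_card_out
    simp only [sum_add_distrib, ← mul_sum, sum_const, card_univ, smul_eq_mul] at h1 h2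
    omega

theorem hasAntimagicOrientation [Fintype V] (F : Frame G) : HasAntimagicOrientation G := by
  classical
  let E : Finset (Sym2 V) := {e | e ∈ G.edgeSet ∧ ∀ v ∈ e, v ∉ F.X}
  have hE (u v : V) : s(u, v) ∈ E ↔ G.Adj u v ∧ u ∉ F.X ∧ v ∉ F.X := by simp [E]
  obtain ⟨lab, hlab⟩ := F.exists_slot_labeling #E
  obtain ⟨g, hg, hg0, hgy⟩ := hlab.exists_y
  obtain ⟨arc, ha1, ha2, ha3, ha4⟩ := exists_orientation_sum_ge g hg hg0 E
    (Fintype.card (F.Slots #E)) (by positivity) (fun i hi => by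
      rw [← hgy ⟨i, hi⟩]; exact hlab.le_m _)
  have harc : F.IsArcs arc :=
    { notMem_left := fun i => ((hE _ _).1 (ha1 i)).2.1
      notMem_right := fun i => ((hE _ _).1 (ha1 i)).2.2
      adj := fun i => ((hE _ _).1 (ha1 i)).1
      injective := ha2
      surjective := fun u v hu hv huv => ha3 _ ((hE u v).2 ⟨huv, hu, hv⟩) }
  obtain ⟨π, hπ⟩ := exists_perm_add_injective
    (fun y : {y // y ∉ F.X} => F.net arc lab y - lab (.r (F.M y))) (fun y => lab (.r (F.M y)))
    (fun y y' hy => F.M_inj (by simpa using hlab.injective hy))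
  let ι : {y // y ∉ F.X} ↪ F.X := ⟨F.M, F.M_inj⟩
  -- Root labels move along matching edges only; `comp_perm` preserves all that is used on `X`.
  let ρ : Equiv.Perm F.X := π.viaEmbedding ι
  have hlab' := hlab.comp_perm ρ
  set lab' := lab ∘ Slot.map ρ id id id id id
  have hnet (y : {y // y ∉ F.X}) : F.net arc lab' y =
      F.net arc lab y - lab (.r (F.M y)) + lab (.r (F.M (π y))) := by
    rw [net_comp_perm lab ρ (fun x hx => π.viaEmbedding_apply_of_notMem ι x hx)]
    congr 3
    exact (π.viaEmbedding_apply ι y)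
  have hlow (y : {y // y ∉ F.X}) : -(Fintype.card (F.Slots #E) : ℤ) + 1 ≤ F.net arc lab' y := by
    refine net_ge hlab'.one_le ?_ y
    intro v
    refine (ha4 v).trans_eq ?_
    refine sum_congr rfl fun i _ => ?_
    have : lab' (.y i) = g i := hgy i
    rw [this]
  have hhigh (x : F.X) := net_lt harc (by positivity) hlab' x
  refine ⟨F.digraph arc, isOrientation harc, Function.extend (F.slotArc arc) lab' 0,
    bijOn_extend harc rfl hlab'.injective hlab'.one_le hlab'.le_m, ?_⟩
  intro u v huv
  rw [orientedSum_extend harc, orientedSum_extend harc] at huv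
  by_cases hu : u ∈ F.X <;> by_cases hv : v ∈ F.X
  · by_contra hne
    exact net_ne harc hlab' (x := ⟨u, hu⟩) (x' := ⟨v, hv⟩) (by simpa using hne) huv
  · have h1 := hhigh ⟨u, hu⟩
    have h2 := hlow ⟨v, hv⟩
    dsimp only at h1 h2
    linarith
  · have h1 := hhigh ⟨v, hv⟩
    have h2 := hlow ⟨u, hu⟩
    dsimp only at h1 h2
    linarith
  · have h1 := hnet ⟨u, hu⟩
    have h2 := hnet ⟨v, hv⟩
    exact congrArg Subtype.val (@hπ ⟨u, hu⟩ ⟨v, hv⟩ (h1.symm.trans (huv.trans h2)))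

end Frame

end FrameLabeling

/-! ### Existence of a frame at minimum degree 33. -/

section FrameExistence

theorem exists_equiv_apply_eq {A B : Type*} [Fintype A] [Fintype B]
    (h : Fintype.card A = Fintype.card B) (a : A) (b : B) : ∃ φ : A ≃ B, φ a = b := by
  classical
  obtain ⟨φ⟩ := Fintype.card_eq.1 h
  exact ⟨φ.trans (Equiv.swap (φ a) b), by simp⟩

/-- The numbers of roles at a vertex with `h` outer neighbours, and with `p` in-neighbours and `q`
out-neighbours in the inner part. -/
theorem exists_role_sizes {h p q : ℕ} (hd : 33 ≤ h + (p + q)) (hpq : p + q ≤ h)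
    (hbal : 16 ≤ p + q → 4 ≤ p ∧ 4 ≤ q) : ∃ e o l c : ℕ, e ≤ 1 ∧ o ≤ 1 ∧ (e = 0 → l < q + c) ∧
      (e = 1 → l ≤ q + c) ∧ p = 2 * l + o ∧ h = 1 + 3 * e + q + o + 2 * c := by
  -- `e` is forced by parity in the formula for `h`, since `o` has the parity of `p`. If `p + q <
  -- 16` then `h ≥ 18`; otherwise `hbal` provides the slack.
  refine ⟨(h + p + q + 1) % 2, p % 2, p / 2,
    (h - 1 - 3 * ((h + p + q + 1) % 2) - q - p % 2) / 2, ?_, ?_, ?_, ?_, ?_, ?_⟩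
  all_goals by_cases hi : 16 ≤ p + q
  all_goals (try have := hbal hi)
  all_goals omega

variable {V : Type*} [Fintype V]

theorem exists_frame (G : SimpleGraph V) [DecidableRel G.Adj] (hG : 33 ≤ G.minDegree) :
    Nonempty (Frame G) := by
  classical
  obtain ⟨X, hX, M, hM, hMX⟩ := exists_partition G
  let H : SimpleGraph X := G.comap Subtype.val
  obtain ⟨O, hO, hO', hbal⟩ := exists_balanced_orientation H
  have hdegO (x : X) : H.degree x =
      Fintype.card {u // O u x} + Fintype.card {v // O x v} := by
    rw [Fintype.card_subtype, Fintype.card_subtype, ← card_union_of_disjoint,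
      ← H.card_neighborFinset_eq_degree]
    · congr 1
      ext u
      rw [SimpleGraph.mem_neighborFinset, hO]
      simp [or_comm]
    · rw [disjoint_filter]
      exact fun u _ => hO' u x
  have hdegX (x : X) : degIn G X x = H.degree x := by
    rw [← H.card_neighborFinset_eq_degree, degIn, ← card_map (Function.Embedding.subtype (· ∈ X))]
    congr 1
    ext u
    simp [H, and_comm]
  have hdegY (x : X) : degIn G Xᶜ x = Fintype.card {y // y ∉ X ∧ G.Adj x y} := by
    rw [Fintype.card_subtype, degIn]
    congr 1
    ext u
    simp
  have hdeg (x : X) : 33 ≤ degIn G Xᶜ x + degIn G X x := by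
    have h1 : degIn G Xᶜ x + degIn G X x = G.degree x := by
      rw [← degIn_union disjoint_compl_left, degIn, ← G.card_neighborFinset_eq_degree]
      congr 1
      ext u
      simp
      tauto
    rw [h1]
    exact hG.trans (G.minDegree_le_degree _)
  have hle (x : X) := hX x x.2
  have hbal' (x : X) : 16 ≤ Fintype.card {u // O u x} + Fintype.card {v // O x v} →
      4 ≤ Fintype.card {u // O u x} ∧ 4 ≤ Fintype.card {v // O x v} := by
    rw [← hdegO, Fintype.card_subtype, Fintype.card_subtype]
    intro h
    convert hbal x (by convert h)
  choose e o l c he ho hlt hle' hp hh using fun x : X => exists_role_sizes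
    (h := Fintype.card {y // y ∉ X ∧ G.Adj x y}) (p := Fintype.card {u // O u x})
    (q := Fintype.card {v // O x v})
    (by rw [← hdegO, ← hdegX, ← hdegY]; exact hdeg x)
    (by rw [← hdegO, ← hdegX, ← hdegY]; exact hle x) (hbal' x)
  let M' : {y // y ∉ X} → X := fun y => ⟨M y, (hMX y (mem_compl.2 y.2)).2⟩
  have hM' : Function.Injective M' := fun y y' h => Subtype.ext
    (hM (mem_coe.2 (mem_compl.2 y.2)) (mem_coe.2 (mem_compl.2 y'.2)) (congrArg Subtype.val h))
  -- The root is the matched partner if there is one, otherwise arbitrary.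
  have hroot (x : X) : ∃ b : {y // y ∉ X ∧ G.Adj x y}, ∀ y, M' y = x → (b : V) = y := by
    by_cases h : ∃ y, M' y = x
    · obtain ⟨y, rfl⟩ := h
      exact ⟨⟨y, y.2, (hMX y (mem_compl.2 y.2)).1.symm⟩, fun y' hy' => by rw [hM' hy']⟩
    · have : 0 < Fintype.card {y // y ∉ X ∧ G.Adj x y} := by rw [hh x]; omega
      obtain ⟨b⟩ := Fintype.card_pos_iff.1 this
      exact ⟨b, fun y hy => absurd ⟨y, hy⟩ h⟩
  choose root hroot using hroot
  have hφ (x : X) : ∃ φ : Unit ⊕ (Fin (e x) × Fin 3) ⊕ {v // O x v} ⊕ Fin (o x) ⊕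
      (Fin (c x) × Fin 2) ≃ {y // y ∉ X ∧ G.Adj x y}, φ (.inl ()) = root x := by
    apply exists_equiv_apply_eq
    rw [hh x]
    simp
    ring
  choose φ hφ using hφ
  have hχ (x : X) : Nonempty ((Fin (l x) × Fin 2) ⊕ Fin (o x) ≃ {u // O u x}) := by
    apply Fintype.card_eq.1
    rw [hp x]
    simp [mul_comm]
  -- `X` is at least as large as `Y`, which contains the at least 17 outer neighbours of a vertex of
  -- `X`.
  have hcard : 17 ≤ Fintype.card X := by
    have hne : Nonempty V := by
      by_contra hV
      have : IsEmpty V := not_nonempty_iff.1 hV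
      simp [SimpleGraph.minDegree] at hG
    have hXne : Nonempty X := by
      obtain ⟨v⟩ := hne
      by_cases hv : v ∈ X
      · exact ⟨⟨v, hv⟩⟩
      · exact ⟨M' ⟨v, hv⟩⟩
    obtain ⟨x⟩ := hXne
    have h1 : Fintype.card {y // y ∉ X ∧ G.Adj x y} ≤ Fintype.card {y // y ∉ X} :=
      Fintype.card_subtype_mono _ _ (fun y hy => hy.1)
    have h2 := Fintype.card_le_of_injective M' hM'
    have h3 := hdeg x
    have h4 := hle x
    rw [hdegY] at h3 h4
    omega
  exact ⟨{
    X := X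
    O := O
    O_adj := fun u v => hO u v
    O_asymm := hO'
    e := e
    o := o
    l := l
    c := c
    e_le := he
    o_le := ho
    lt_of_e_eq_zero := fun x h => by convert hlt x h
    le_of_e_eq_one := fun x h => by convert hle' x h
    -- The expression is outer degree plus full degree, at least `17 + 33`.
    count := fun x => by
      have h1 := hdeg x
      have h2 := hle x
      rw [hdegX, hdegO, hdegY, hh x, hp x] at h1 h2
      convert (show 50 ≤ 2 + 6 * e x + 3 * Fintype.card {v // O x v} + 3 * o x + 4 * c x +
        2 * l x by omega)
    card_X := hcard
    φ := φ
    χ := fun x => (hχ x).some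
    M := M'
    M_inj := hM'
    φ_M := fun y => by rw [hφ]; exact hroot _ y rfl }⟩

end FrameExistence

end AntimagicOrientation

theorem theorem2 {V : Type*} [Fintype V] (G : SimpleGraph V) [DecidableRel G.Adj]
    (hG : 33 ≤ G.minDegree) : AntimagicOrientation.HasAntimagicOrientation G := by
  obtain ⟨F⟩ := AntimagicOrientation.exists_frame G hG
  exact F.hasAntimagicOrientation
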